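/- Let $\Omega\subset\mathbb{R}^2$ be a bounded convex domain (non-empty, open) with $C^1$ boundary, let $|\partial\Omega|$ be the length of its boundary, and let $\{x\}=x-\lfloor x\rfloor$. Consider 1-rectifiable sets $\mathcal{L}\subset\overline{\Omega}$ whose points may be counted with multiplicity, so that several copies of the same curve are allowed: such a set is given by a multiplicity function $\theta:\mathbb{R}^2\to\mathbb{N}_0$ that is measurable with respect to the one-dimensional Hausdorff measure $\mathcal{H}^1$, vanishes outside $\overline{\Omega}$, and whose support $\{\theta\neq 0\}$ is, up to an $\mathcal{H}^1$-null set, covered by countably many Lipschitz curves. Its length is $|\mathcal{L}|=\int\theta\,d\mathcal{H}^1$ and its number of intersections with a line $\ell$ is $n_\ell(\mathcal{L})=\sum_{x\in\ell}\theta(x)$. Let $\mu$ be the kinematic measure $d\phi\,dp$ on the lines $\{x: x_1\cos\phi+x_2\sin\phi=p\}$ with $\phi\in[0,2\pi)$, $p\in\mathbb{R}$ (each line is counted once for each orientation, so that Crofton's formula reads $|\mathcal{L}|=\frac14\int n_\ell(\mathcal{L})\,d\mu(\ell)$). For $L\ge 0$ let $$E_\Omega(L)=\inf_{|\mathcal{L}|=L}\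 \frac14\int n_\ell(\mathcal{L})^2\,d\mu(\ell),$$ the infimum being taken over all such $\mathcal{L}$ of length $L$. Then, for every $L\ge 0$, $E_\Omega(L)$ is finite and $$\frac{|\partial\Omega|}{2}\left\{\frac{2L}{|\partial\Omega|}\right\}\left(1-\left\{\frac{2L}{|\partial\Omega|}\right\}\right)\ \le\ E_\Omega(L)-\frac{2L^2}{|\partial\Omega|}\ \le\ \frac{|\partial\Omega|}{4}.$$ If moreover $n|\partial\Omega|\le L\le n|\partial\Omega|+\operatorname{diam}(\Omega)$ for some integer $n\ge 0$, then the lower bound is an equality; in that case there are line segments in $\overline{\Omega}$ of length $L-n|\partial\Omega|$, and for every such segment the union of $n$ copies of $\partial\Omega$ and the segment (counted with multiplicity) has length $L$ and attains the infimum $E_\Omega(L)$. -/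

import Mathlib

open MeasureTheory Set
open scoped ENNReal Topology

noncomputable section

/-- The Euclidean plane. -/
abbrev Plane : Type := EuclideanSpace ℝ (Fin 2)

/-- The boundary of the open set `Ω` is of class `C¹`: near each boundary point, `Ω` is the sublevel
set `{g < 0}` of a `C¹` function `g` with non-vanishing derivative at that point. -/
def HasC1Boundary (Ω : Set Plane) : Prop :=
  ∀ p ∈ frontier Ω, ∃ (U : Set Plane) (g : Plane → ℝ), IsOpen U ∧ p ∈ U ∧
    ContDiffOn ℝ 1 g U ∧ fderiv ℝ g p ≠ 0 ∧ Ω ∩ U = {x ∈ U | g x < 0}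

/-- The length `|∂Ω|` of the boundary, i.e. its one-dimensional Hausdorff measure. -/
def boundaryLength (Ω : Set Plane) : ℝ := (μH[1] (frontier Ω)).toReal

/-- A 1-rectifiable set: measurable for the one-dimensional Hausdorff measure `μH[1]`, and covered,
up to a `μH[1]`-null set, by countably many Lipschitz curves. -/
def IsOneRectifiable (S : Set Plane) : Prop :=
  NullMeasurableSet S (μH[1] : Measure Plane) ∧
    ∃ f : ℕ → ℝ → Plane, (∀ i, ∃ K, LipschitzWith K (f i)) ∧
      (μH[1] : Measure Plane) (S \ ⋃ i, range (f i)) = 0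

/-- A 1-rectifiable set whose points are counted with multiplicity (so that several copies of the
same curve may be used) is described by its multiplicity function `θ : Plane → ℕ`. An ordinary set
is the case in which `θ` is its indicator function. -/
def IsOneRectifiableMultiset (θ : Plane → ℕ) : Prop :=
  NullMeasurable θ (μH[1] : Measure Plane) ∧ IsOneRectifiable {x | θ x ≠ 0}

/-- The length, counted with multiplicity. -/
def multisetLength (θ : Plane → ℕ) : ℝ≥0∞ := ∫⁻ x, (θ x : ℝ≥0∞) ∂(μH[1] : Measure Plane)

/-- The line with unit normal `(cos φ, sin φ)` and signed distance `p` from the origin,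
where `q = (φ, p)`. -/
def lineOf (q : ℝ × ℝ) : Set Plane := {x | x 0 * Real.cos q.1 + x 1 * Real.sin q.1 = q.2}

/-- The kinematic measure `dφ dp` on lines, `φ ∈ [0, 2π)`, `p ∈ ℝ`. Each line occurs for two
values of `(φ, p)`, one for each orientation; this is the normalization for which Crofton's formula
has the factor `1/4`. -/
def kinematicMeasure : Measure (ℝ × ℝ) :=
  (volume.restrict (Ico 0 (2 * Real.pi))).prod volume

/-- The number of intersections, with multiplicity, of `θ` with the line given by `q`. -/
def intersectionNumber (θ : Plane → ℕ) (q : ℝ × ℝ) : ℝ≥0∞ :=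
  ∑' x : lineOf q, (θ x : ℝ≥0∞)

/-- The energy: a quarter of the integral of the squared intersection number over all lines. -/
def croftonEnergy (θ : Plane → ℕ) : ℝ≥0∞ :=
  (∫⁻ q, intersectionNumber θ q ^ 2 ∂kinematicMeasure) / 4

/-- The competitors: 1-rectifiable sets (with multiplicity) of length `L` in the closure of `Ω`. -/
def IsCompetitor (Ω : Set Plane) (L : ℝ) (θ : Plane → ℕ) : Prop :=
  IsOneRectifiableMultiset θ ∧ {x | θ x ≠ 0} ⊆ closure Ω ∧ multisetLength θ = ENNReal.ofReal L

/-- The minimal energy `E_Ω(L)`. -/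
def minEnergy (Ω : Set Plane) (L : ℝ) : ℝ≥0∞ :=
  ⨅ (θ : Plane → ℕ) (_ : IsCompetitor Ω L θ), croftonEnergy θ

/-- The union of `n` copies of `∂Ω` and the line segment from `a` to `b`, with multiplicity. -/
def copiesWithSegment (Ω : Set Plane) (n : ℕ) (a b : Plane) : Plane → ℕ :=
  fun x => n * (frontier Ω).indicator 1 x + (segment ℝ a b).indicator 1 x

end

open Filter
open scoped NNReal

noncomputable section

/-! Write P for the boundary length. Almost every line that meets the closure of the domain meets
the open domain, and then it crosses the boundary in exactly two points. With Crofton's formula the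
lines meeting the domain therefore have measure 2P. A competitor of length L thus has an
integer-valued intersection number on a space of measure 2P, with integral 4L and mean x = 2L/P, and
the energy is its second moment. By Jensen the energy is at least 2L²/P. The fractional-part term is
the price of integrality: for k = ⌊x⌋ every integer m satisfies (m - k)(m - k - 1) ≥ 0, and
integrating m² ≥ (2k + 1)m - k(k + 1) gives exactly the lower bound (`ofReal_le_croftonEnergy`). The
coefficient of m is positive, so only the inequality 4·length ≤ ∫ n is needed for general
rectifiable sets (`four_mul_multisetLength_le_lintegral`). It is proved by cutting curves into
almost linear pieces.

Equality: n boundary copies and a segment meet almost every line through the domain 2n or 2n + 1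
times, which are consecutive integers.

Upper bound: take n = ⌊L/P⌋ copies of the boundary and a measurable part A of it of length r = L -
nP. The energy exceeds that of the copies by 4nr + r + D/2, where D measures the lines with both
boundary points in A. For an A spread randomly over the boundary a line has both points in A with
probability about (r/P)², so D is about 2r²/P, and the excess over 2L²/P is r - r²/P ≤ P/4. This is
made deterministic by dividing the boundary into N equal arcs and choosing, by averaging, a
subfamily with few lines joining two of its arcs (`IsArclengthParam.exists_subset_caught_le`). Lines
with both points in one arc are negligible as N grows. -/

/-! ### Lines meeting a set, and their kinematic measure -/

/-- The signed distance from the origin of the line with normal direction `φ` through `x`. -/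
def normalCoord (φ : ℝ) (x : Plane) : ℝ := x 0 * Real.cos φ + x 1 * Real.sin φ

/-- The set of (parameters of) lines that meet `A`. -/
def linesMeeting (A : Set Plane) : Set (ℝ × ℝ) := {q | ∃ x ∈ A, normalCoord q.1 x = q.2}

lemma mem_lineOf {q : ℝ × ℝ} {x : Plane} : x ∈ lineOf q ↔ normalCoord q.1 x = q.2 := Iff.rfl

lemma mem_linesMeeting {A : Set Plane} {q : ℝ × ℝ} :
    q ∈ linesMeeting A ↔ ∃ x ∈ A, normalCoord q.1 x = q.2 := Iff.rfl

lemma normalCoord_add (φ : ℝ) (x y : Plane) :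
    normalCoord φ (x + y) = normalCoord φ x + normalCoord φ y := by
  simp [normalCoord]; ring

lemma normalCoord_smul (φ c : ℝ) (x : Plane) :
    normalCoord φ (c • x) = c * normalCoord φ x := by
  simp [normalCoord]; ring

lemma normalCoord_sub (φ : ℝ) (x y : Plane) :
    normalCoord φ (x - y) = normalCoord φ x - normalCoord φ y := by
  simp [normalCoord]; ring

lemma Plane.norm_sq (x : Plane) : ‖x‖ ^ 2 = x 0 ^ 2 + x 1 ^ 2 := by
  simp [EuclideanSpace.norm_sq_eq, Fin.sum_univ_two]

lemma abs_normalCoord_le (φ : ℝ) (x : Plane) : |normalCoord φ x| ≤ ‖x‖ := by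
  apply abs_le_of_sq_le_sq _ (norm_nonneg x)
  rw [Plane.norm_sq, normalCoord]
  nlinarith [sq_nonneg (x 0 * Real.sin φ - x 1 * Real.cos φ), Real.sin_sq_add_cos_sq φ]

/-- `normalCoord φ` as a linear map. -/
def normalCoordLin (φ : ℝ) : Plane →ₗ[ℝ] ℝ where
  toFun := normalCoord φ
  map_add' := normalCoord_add φ
  map_smul' := fun c x => by simp [normalCoord_smul]

lemma lipschitzWith_normalCoord (φ : ℝ) : LipschitzWith 1 (normalCoord φ) := by
  apply LipschitzWith.of_dist_le_mul
  intro x y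
  rw [Real.dist_eq, ← normalCoord_sub, dist_eq_norm]
  simpa using abs_normalCoord_le φ (x - y)

lemma continuous_normalCoord_uncurry :
    Continuous fun z : ℝ × Plane => normalCoord z.1 z.2 := by
  unfold normalCoord
  fun_prop

lemma linesMeeting_mono {A B : Set Plane} (h : A ⊆ B) : linesMeeting A ⊆ linesMeeting B :=
  fun _ ⟨x, hx, hq⟩ => ⟨x, h hx, hq⟩

lemma linesMeeting_iUnion {ι : Sort*} (A : ι → Set Plane) :
    linesMeeting (⋃ i, A i) = ⋃ i, linesMeeting (A i) := by
  ext q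
  simp only [mem_linesMeeting, mem_iUnion]
  constructor
  · rintro ⟨x, ⟨i, hi⟩, h⟩; exact ⟨i, x, hi, h⟩
  · rintro ⟨i, x, hi, h⟩; exact ⟨x, ⟨i, hi⟩, h⟩

lemma linesMeeting_union (A B : Set Plane) :
    linesMeeting (A ∪ B) = linesMeeting A ∪ linesMeeting B := by
  ext q
  simp only [mem_linesMeeting, mem_union, or_and_right, exists_or]

lemma linesMeeting_empty : linesMeeting ∅ = ∅ := by
  ext q; simp [mem_linesMeeting]

/-- The incidence relation is closed, and projecting along a compact factor is a closed map. -/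
lemma isClosed_linesMeeting {K : Set Plane} (hK : IsCompact K) : IsClosed (linesMeeting K) := by
  have hc : IsClosed {z : (ℝ × ℝ) × K | normalCoord z.1.1 z.2 = z.1.2} :=
    isClosed_eq (continuous_normalCoord_uncurry.comp
      (f := fun z : (ℝ × ℝ) × K => (z.1.1, (z.2 : Plane))) (by fun_prop)) (by fun_prop)
  have : CompactSpace K := isCompact_iff_compactSpace.1 hK
  have := isClosedMap_fst_of_compactSpace (X := ℝ × ℝ) (Y := K) _ hc
  convert this using 1
  ext q
  simp [mem_linesMeeting]

lemma measurableSet_linesMeeting {K : Set Plane} (hK : IsSigmaCompact K) :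
    MeasurableSet (linesMeeting K) := by
  obtain ⟨C, hC, rfl⟩ := hK
  rw [linesMeeting_iUnion]
  exact MeasurableSet.iUnion fun i => (isClosed_linesMeeting (hC i)).measurableSet

lemma isOpen_linesMeeting {U : Set Plane} (hU : IsOpen U) : IsOpen (linesMeeting U) := by
  rw [isOpen_iff_mem_nhds]
  rintro q ⟨x, hx, hq⟩
  -- `F r` is the orthogonal projection of `x` to the line `r`. It depends continuously on `r`, so
  -- it stays in `U` for nearby lines.
  let F : ℝ × ℝ → Plane := fun r =>
    x + (r.2 - normalCoord r.1 x) • !₂[Real.cos r.1, Real.sin r.1]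
  have hF : Continuous F := by
    have h1 : Continuous fun r : ℝ × ℝ => normalCoord r.1 x :=
      continuous_normalCoord_uncurry.comp (f := fun r : ℝ × ℝ => (r.1, x)) (by fun_prop)
    have h2 : Continuous fun r : ℝ × ℝ => (!₂[Real.cos r.1, Real.sin r.1] : Plane) := by
      refine (PiLp.continuous_toLp 2 _).comp (continuous_pi fun i => ?_)
      fin_cases i <;> simp <;> fun_prop
    exact continuous_const.add ((continuous_snd.sub h1).smul h2)
  have hFq : F q = x := by simp [F, hq]
  have : F ⁻¹' U ∈ 𝓝 q := hF.continuousAt.preimage_mem_nhds (by rw [hFq]; exact hU.mem_nhds hx)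
  filter_upwards [this] with r hr
  refine ⟨F r, hr, ?_⟩
  simp only [F, normalCoord_add, normalCoord_smul]
  have : normalCoord r.1 !₂[Real.cos r.1, Real.sin r.1] = 1 := by
    simp only [normalCoord]
    simpa [sq] using Real.cos_sq_add_sin_sq r.1
  rw [this]; ring

lemma kinematicMeasure_apply {E : Set (ℝ × ℝ)} (hE : MeasurableSet E) :
    kinematicMeasure E = ∫⁻ φ in Ico 0 (2 * Real.pi), volume (Prod.mk φ ⁻¹' E) := by
  rw [kinematicMeasure, Measure.prod_apply hE]

/-- This half of Fubini holds for arbitrary `E`, which matters because the line sets of arbitrary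
pieces of curves are not known to be measurable. -/
lemma lintegral_section_le_kinematicMeasure (E : Set (ℝ × ℝ)) :
    ∫⁻ φ in Ico 0 (2 * Real.pi), volume (Prod.mk φ ⁻¹' E) ≤ kinematicMeasure E := by
  rw [← measure_toMeasurable E, kinematicMeasure_apply (measurableSet_toMeasurable _ _)]
  exact lintegral_mono fun φ => measure_mono (preimage_mono (subset_toMeasurable _ _))

lemma section_linesMeeting (φ : ℝ) (A : Set Plane) :
    Prod.mk φ ⁻¹' linesMeeting A = normalCoord φ '' A := by
  ext p; simp [mem_linesMeeting]

lemma volume_restrict_Ico_univ :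
    (volume.restrict (Ico 0 (2 * Real.pi))) univ = ENNReal.ofReal (2 * Real.pi) := by
  simp

lemma kinematicMeasure_linesMeeting_le_of_subset_closedBall {A : Set Plane} {x : Plane} {d : ℝ}
    (h : A ⊆ Metric.closedBall x d) :
    kinematicMeasure (linesMeeting A) ≤ ENNReal.ofReal (2 * d) * ENNReal.ofReal (2 * Real.pi) := by
  refine (measure_mono (linesMeeting_mono h)).trans ?_
  rw [kinematicMeasure_apply
    (isClosed_linesMeeting (isCompact_closedBall x d)).measurableSet]
  calc ∫⁻ φ in Ico 0 (2 * Real.pi), volume (Prod.mk φ ⁻¹' linesMeeting (Metric.closedBall x d))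
      ≤ ∫⁻ φ in Ico 0 (2 * Real.pi), ENNReal.ofReal (2 * d) := by
        refine lintegral_mono fun φ => ?_
        rw [section_linesMeeting, ← Real.volume_closedBall (normalCoord φ x)]
        refine measure_mono ?_
        rintro _ ⟨y, hy, rfl⟩
        have := (lipschitzWith_normalCoord φ).dist_le_mul y x
        simp only [NNReal.coe_one, one_mul] at this
        exact this.trans hy
    _ = _ := by rw [lintegral_const, volume_restrict_Ico_univ]

/-! ### Null sets and measurability of line sets -/

/-- The measure of the set of lines meeting `A`, as an outer measure in `A`. -/
def linesMeetingOuter : OuterMeasure Plane where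
  measureOf A := kinematicMeasure (linesMeeting A)
  empty := by simp [linesMeeting_empty]
  mono h := measure_mono (linesMeeting_mono h)
  iUnion_nat s _ := by rw [linesMeeting_iUnion]; exact measure_iUnion_le _

/-- Almost no line meets a set of zero length. -/
lemma kinematicMeasure_linesMeeting_eq_zero {N : Set Plane} (hN : μH[1] N = 0) :
    kinematicMeasure (linesMeeting N) = 0 := by
  set C : ℝ≥0∞ := 2 * ENNReal.ofReal (2 * Real.pi) with hCdef
  have hC0 : C ≠ 0 := by simp [C, Real.pi_pos]
  have hCt : C ≠ ⊤ := by simp [C, ENNReal.mul_eq_top]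
  -- The lines meeting a set of diameter d have measure at most 2d·2π. An outer measure bounded by
  -- the diameter on small sets is bounded by the one-dimensional Hausdorff measure.
  have key : C⁻¹ • linesMeetingOuter ≤
      OuterMeasure.mkMetric (X := Plane) fun r => r ^ (1 : ℝ) := by
    refine OuterMeasure.le_mkMetric _ _ 1 one_pos fun s hs => ?_
    rcases s.eq_empty_or_nonempty with rfl | ⟨x, hx⟩
    · simp
    have hfin : Metric.ediam s ≠ ⊤ := ne_top_of_le_ne_top ENNReal.one_ne_top hs
    have hsub : s ⊆ Metric.closedBall x (Metric.diam s) := fun y hy =>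
      Metric.dist_le_diam_of_mem (Metric.isBounded_iff_ediam_ne_top.2 hfin) hy hx
    have h1 : linesMeetingOuter s ≤ C * Metric.ediam s := by
      refine (kinematicMeasure_linesMeeting_le_of_subset_closedBall hsub).trans_eq ?_
      rw [ENNReal.ofReal_mul zero_le_two, Metric.diam, ENNReal.ofReal_toReal hfin, hCdef]
      simp only [ENNReal.ofReal_ofNat]
      ring
    rw [ENNReal.rpow_one]
    calc (C⁻¹ • linesMeetingOuter) s = C⁻¹ * linesMeetingOuter s := rfl
      _ ≤ C⁻¹ * (C * Metric.ediam s) := by gcongr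
      _ = Metric.ediam s := by rw [← mul_assoc, ENNReal.inv_mul_cancel hC0 hCt, one_mul]
  have h2 := key N
  have h3 : (OuterMeasure.mkMetric (X := Plane) fun r => r ^ (1 : ℝ)) N = 0 := by
    have : (μH[1] : Measure Plane).toOuterMeasure = OuterMeasure.mkMetric fun r => r ^ (1:ℝ) :=
      Measure.mkMetric_toOuterMeasure _
    rw [← this]; exact hN
  rw [h3] at h2
  have h4 : C⁻¹ * kinematicMeasure (linesMeeting N) = 0 := le_antisymm h2 zero_le
  rcases mul_eq_zero.1 h4 with h | h
  · exact absurd h (ENNReal.inv_ne_zero.2 hCt)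
  · exact h

lemma ae_notMem_linesMeeting {N : Set Plane} (hN : μH[1] N = 0) :
    ∀ᵐ q ∂kinematicMeasure, q ∉ linesMeeting N := by
  rw [ae_iff]; simpa using kinematicMeasure_linesMeeting_eq_zero hN

/-- Inner regularity. The lines meeting a σ-compact set form a countable union of closed sets,
whereas for a merely measurable set they are a projection whose measurability is unclear. The
discarded part has zero length and so is met by almost no line. -/
lemma exists_isSigmaCompact_subset {A : Set Plane} (hA : NullMeasurableSet A (μH[1]))
    (hfin : μH[1] A ≠ ⊤) :
    ∃ K ⊆ A, IsSigmaCompact K ∧ μH[1] (A \ K) = 0 := by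
  obtain ⟨B, hBA, hB, hAB⟩ := hA.exists_measurable_subset_ae_eq
  have hBfin : μH[1] B ≠ ⊤ := ne_top_of_le_ne_top hfin (measure_mono hBA)
  have : IsFiniteMeasure ((μH[1] : Measure Plane).restrict B) :=
    ⟨by simpa using hBfin.lt_top⟩
  have hex : ∀ n : ℕ, ∃ C ⊆ B, IsCompact C ∧
      (μH[1] : Measure Plane).restrict B (B \ C) < ((n : ℝ≥0∞) + 1)⁻¹ := fun n =>
    hB.exists_isCompact_sdiff_lt (by simpa using hBfin) (by simp [ENNReal.add_eq_top])
  choose C hCB hC hlt using hex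
  refine ⟨⋃ n, C n, (iUnion_subset hCB).trans hBA, isSigmaCompact_iUnion_of_isCompact C hC, ?_⟩
  have h1 : μH[1] (B \ ⋃ n, C n) = 0 := by
    have hle : ∀ n : ℕ, μH[1] (B \ ⋃ n, C n) ≤ ((n : ℝ≥0∞) + 1)⁻¹ := fun n => by
      have := (hlt n).le
      rw [Measure.restrict_apply' hB, inter_eq_left.2 sdiff_subset] at this
      exact (measure_mono (sdiff_subset_sdiff_right (subset_iUnion C n))).trans this
    have ht := (tendsto_add_atTop_iff_nat 1).2 ENNReal.tendsto_inv_nat_nhds_zero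
    simp only [Nat.cast_add, Nat.cast_one] at ht
    exact le_antisymm (ge_of_tendsto' ht hle) zero_le
  have h2 : μH[1] (A \ B) = 0 := (ae_le_set.1 hAB.symm.le)
  refine measure_mono_null ?_ (measure_union_null h1 h2)
  intro x ⟨hx, hx'⟩
  by_cases hxB : x ∈ B
  · exact Or.inl ⟨hxB, hx'⟩
  · exact Or.inr ⟨hx, hxB⟩

lemma nullMeasurableSet_linesMeeting {A : Set Plane} (hA : NullMeasurableSet A (μH[1]))
    (hfin : μH[1] A ≠ ⊤) : NullMeasurableSet (linesMeeting A) kinematicMeasure := by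
  obtain ⟨K, hKA, hK, h0⟩ := exists_isSigmaCompact_subset hA hfin
  rw [← union_sdiff_cancel hKA, linesMeeting_union]
  exact (measurableSet_linesMeeting hK).nullMeasurableSet.union
    (NullMeasurableSet.of_null (kinematicMeasure_linesMeeting_eq_zero h0))

/-! ### Crofton's formula for segments -/

lemma intervalIntegral_abs_cos : ∫ φ in (0 : ℝ)..(2 * Real.pi), |Real.cos φ| = 4 := by
  have hper : Function.Periodic (fun φ => |Real.cos φ|) (2 * Real.pi) := fun φ => by simp
  have h := hper.intervalIntegral_add_eq 0 (-(Real.pi / 2))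
  rw [zero_add] at h
  rw [h]
  have hint : ∀ a b : ℝ, IntervalIntegrable (fun φ => |Real.cos φ|) volume a b := fun a b =>
    (Real.continuous_cos.abs).intervalIntegrable a b
  rw [← intervalIntegral.integral_add_adjacent_intervals (hint _ (Real.pi / 2)) (hint _ _)]
  have h1 : ∫ φ in (-(Real.pi / 2))..(Real.pi / 2), |Real.cos φ| = 2 := by
    rw [intervalIntegral.integral_congr (g := Real.cos)]
    · simp; norm_num
    · intro φ hφ
      rw [uIcc_of_le (by linarith [Real.pi_pos])] at hφ
      exact abs_of_nonneg (Real.cos_nonneg_of_mem_Icc hφ)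
  have h2 : ∫ φ in (Real.pi / 2)..(-(Real.pi / 2) + 2 * Real.pi), |Real.cos φ| = 2 := by
    rw [intervalIntegral.integral_congr (g := fun φ => -Real.cos φ)]
    · have : -(Real.pi / 2) + 2 * Real.pi = Real.pi / 2 + Real.pi := by ring
      rw [this, intervalIntegral.integral_neg, integral_cos, Real.sin_add_pi]
      simp; norm_num
    · intro φ hφ
      rw [uIcc_of_le (by linarith [Real.pi_pos])] at hφ
      exact abs_of_nonpos (Real.cos_nonpos_of_pi_div_two_le_of_le hφ.1 (by linarith [hφ.2]))
  rw [h1, h2]; norm_num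

/-- The unit vector in direction `t`. -/
def unitVec (t : ℝ) : Plane := !₂[Real.cos t, Real.sin t]

@[simp] lemma unitVec_zero_apply (t : ℝ) : unitVec t 0 = Real.cos t := rfl
@[simp] lemma unitVec_one_apply (t : ℝ) : unitVec t 1 = Real.sin t := rfl

lemma exists_eq_norm_smul_unitVec (v : Plane) : ∃ t, v = ‖v‖ • unitVec t := by
  set z : ℂ := ⟨v 0, v 1⟩ with hz
  have hn : ‖z‖ = ‖v‖ := by
    have h1 : ‖z‖ ^ 2 = ‖v‖ ^ 2 := by
      rw [Complex.sq_norm, Plane.norm_sq, Complex.normSq_apply]; simp [hz, sq]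
    exact (sq_eq_sq₀ (norm_nonneg _) (norm_nonneg _)).1 h1
  refine ⟨z.arg, ?_⟩
  ext i
  fin_cases i
  · simp [← hn, Complex.norm_mul_cos_arg, hz]
  · simp [← hn, Complex.norm_mul_sin_arg, hz]

lemma exists_normalCoord_eq_cos (v : Plane) :
    ∃ α : ℝ, ∀ φ, normalCoord φ v = ‖v‖ * Real.cos (φ - α) := by
  obtain ⟨α, hα⟩ := exists_eq_norm_smul_unitVec v
  refine ⟨α, fun φ => ?_⟩
  rw [hα, normalCoord_smul, ← hα, normalCoord, unitVec_zero_apply, unitVec_one_apply, Real.cos_sub]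
  ring

lemma lintegral_abs_normalCoord (v : Plane) :
    ∫⁻ φ in Ico 0 (2 * Real.pi), ENNReal.ofReal |normalCoord φ v| = ENNReal.ofReal (4 * ‖v‖) := by
  obtain ⟨α, hα⟩ := exists_normalCoord_eq_cos v
  have hc : Continuous fun φ => |normalCoord φ v| := by simp only [hα]; fun_prop
  rw [← ofReal_integral_eq_lintegral_ofReal _ (ae_of_all _ fun φ => abs_nonneg _)]
  · congr 1
    rw [integral_Ico_eq_integral_Ioc,
      ← intervalIntegral.integral_of_le (by linarith [Real.pi_pos])]
    simp only [hα, abs_mul, abs_norm]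
    rw [intervalIntegral.integral_const_mul,
      intervalIntegral.integral_comp_sub_right (fun φ => |Real.cos φ|)]
    have hper : Function.Periodic (fun φ => |Real.cos φ|) (2 * Real.pi) := fun φ => by simp
    have h := hper.intervalIntegral_add_eq (0 - α) 0
    rw [zero_add, intervalIntegral_abs_cos] at h
    rw [show 2 * Real.pi - α = 0 - α + 2 * Real.pi by ring, h]
    ring
  · exact (hc.integrableOn_Icc (a := 0) (b := 2 * Real.pi)).mono_set Ico_subset_Icc_self

lemma isCompact_segment (a b : Plane) : IsCompact (segment ℝ a b) := by
  rw [segment_eq_image_lineMap]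
  exact isCompact_Icc.image AffineMap.lineMap_continuous

/-- The measure of the set of lines meeting a segment. -/
lemma kinematicMeasure_linesMeeting_segment (a b : Plane) :
    kinematicMeasure (linesMeeting (segment ℝ a b)) = ENNReal.ofReal (4 * dist a b) := by
  rw [kinematicMeasure_apply (isClosed_linesMeeting (isCompact_segment a b)).measurableSet,
    dist_comm, dist_eq_norm, ← lintegral_abs_normalCoord]
  refine lintegral_congr fun φ => ?_
  rw [section_linesMeeting]
  have : normalCoord φ '' segment ℝ a b = segment ℝ (normalCoord φ a) (normalCoord φ b) :=
    image_segment ℝ (normalCoordLin φ).toAffineMap a b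
  rw [this, segment_eq_uIcc, uIcc, Real.volume_Icc, normalCoord_sub, max_sub_min_eq_abs]

/-! ### The inequality half of Crofton's formula -/

/-- A map that expands distances by at least `k > 0` has a `k⁻¹`-Lipschitz inverse on its image; `S`
need not be measurable. -/
lemma ofReal_mul_volume_le_volume_image {g : ℝ → ℝ} {S : Set ℝ} {k : ℝ}
    (h : ∀ x ∈ S, ∀ y ∈ S, k * |x - y| ≤ |g x - g y|) :
    ENNReal.ofReal k * volume S ≤ volume (g '' S) := by
  rcases le_or_gt k 0 with hk | hk
  · simp [ENNReal.ofReal_of_nonpos hk]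
  have hinj : InjOn g S := fun x hx y hy hxy => by
    have := h x hx y hy
    rw [hxy, sub_self, abs_zero] at this
    have h2 : |x - y| ≤ 0 := by
      by_contra! h'
      nlinarith [mul_pos hk h']
    exact sub_eq_zero.1 (abs_nonpos_iff.1 h2)
  have hlip : LipschitzOnWith (Real.toNNReal k⁻¹) (Function.invFunOn g S) (g '' S) := by
    apply LipschitzOnWith.of_dist_le_mul
    rintro _ ⟨x, hx, rfl⟩ _ ⟨y, hy, rfl⟩
    rw [hinj.leftInvOn_invFunOn hx, hinj.leftInvOn_invFunOn hy, Real.dist_eq, Real.dist_eq,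
      Real.coe_toNNReal _ (inv_nonneg.2 hk.le), inv_mul_eq_div, le_div_iff₀ hk, mul_comm]
    exact h x hx y hy
  have h1 := hlip.hausdorffMeasure_image_le zero_le_one
  rw [hausdorffMeasure_real, hinj.leftInvOn_invFunOn.image_image, ENNReal.rpow_one] at h1
  calc ENNReal.ofReal k * volume S
      ≤ ENNReal.ofReal k * ((Real.toNNReal k⁻¹ : ℝ≥0∞) * volume (g '' S)) := by gcongr
    _ = volume (g '' S) := by
      rw [← mul_assoc]
      change ENNReal.ofReal k * ENNReal.ofReal k⁻¹ * _ = _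
      rw [← ENNReal.ofReal_mul hk.le, mul_inv_cancel₀ hk.ne', ENNReal.ofReal_one, one_mul]

/-- On a piece where a curve is almost linear, the measure of the set of lines meeting a subset of
the curve is almost at least four times its length. -/
lemma mul_hausdorffMeasure_le_kinematicMeasure_of_almost_linear {f : ℝ → Plane} {S : Set ℝ}
    {v : Plane} {ε : ℝ} (hε : 0 ≤ ε)
    (hf : ∀ x ∈ S, ∀ y ∈ S, ‖f x - f y - (x - y) • v‖ ≤ ε * ‖v‖ * |x - y|)
    {c : ℝ} (hc0 : 0 ≤ c) (hc : c * (1 + ε) ≤ 4 - 2 * Real.pi * ε) {A : Set Plane}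
    (hA : A ⊆ f '' S) :
    ENNReal.ofReal c * μH[1] A ≤ kinematicMeasure (linesMeeting A) := by
  obtain ⟨T, hTS, rfl⟩ := subset_image_iff.1 hA
  have hv := norm_nonneg v
  have hH : μH[1] (f '' T) ≤ ENNReal.ofReal ((1 + ε) * ‖v‖) * volume T := by
    have hlip : LipschitzOnWith (Real.toNNReal ((1 + ε) * ‖v‖)) f T := by
      apply LipschitzOnWith.of_dist_le_mul
      intro x hx y hy
      rw [Real.coe_toNNReal _ (by positivity), dist_eq_norm, Real.dist_eq]
      have h1 := hf x (hTS hx) y (hTS hy)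
      have h2 := norm_le_norm_add_norm_sub' (f x - f y) ((x - y) • v)
      rw [norm_smul, Real.norm_eq_abs] at h2
      nlinarith
    have := hlip.hausdorffMeasure_image_le zero_le_one
    rwa [hausdorffMeasure_real, ENNReal.rpow_one] at this
  -- Seen in direction φ, the piece moves with speed at least |⟨v, u_φ⟩| - ε‖v‖, so its projection
  -- is at least that long per unit of parameter.
  have hsec : ∀ φ, ENNReal.ofReal (|normalCoord φ v| - ε * ‖v‖) * volume T ≤
      volume (normalCoord φ '' (f '' T)) := fun φ => by
    rw [image_image]
    refine ofReal_mul_volume_le_volume_image fun x hx y hy => ?_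
    have h1 := (abs_normalCoord_le φ _).trans (hf x (hTS hx) y (hTS hy))
    rw [normalCoord_sub, normalCoord_sub, normalCoord_smul] at h1
    have h2 := abs_sub_abs_le_abs_sub ((x - y) * normalCoord φ v)
      (normalCoord φ (f x) - normalCoord φ (f y))
    rw [abs_sub_comm ((x - y) * normalCoord φ v), abs_mul] at h2
    nlinarith
  -- Integrating over φ yields 4‖v‖ from the linear part and loses at most 2π·ε‖v‖. Against the
  -- length bound (1 + ε)‖v‖ this is what the hypothesis `hc` compares.
  have hint : ENNReal.ofReal (4 * ‖v‖ - 2 * Real.pi * ε * ‖v‖) ≤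
      ∫⁻ φ in Ico 0 (2 * Real.pi), ENNReal.ofReal (|normalCoord φ v| - ε * ‖v‖) := by
    rw [ENNReal.ofReal_sub _ (by have := Real.pi_pos; positivity), tsub_le_iff_right,
      ← lintegral_abs_normalCoord]
    have : ENNReal.ofReal (2 * Real.pi * ε * ‖v‖) =
        ∫⁻ φ in Ico 0 (2 * Real.pi), ENNReal.ofReal (ε * ‖v‖) := by
      rw [lintegral_const, volume_restrict_Ico_univ, ← ENNReal.ofReal_mul (by positivity)]
      congr 1; ring
    rw [this, ← lintegral_add_right _ measurable_const]
    refine lintegral_mono fun φ => ?_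
    refine le_trans (ENNReal.ofReal_le_ofReal ?_) ENNReal.ofReal_add_le
    linarith
  calc ENNReal.ofReal c * μH[1] (f '' T)
      ≤ ENNReal.ofReal c * (ENNReal.ofReal ((1 + ε) * ‖v‖) * volume T) := by gcongr
    _ = ENNReal.ofReal (c * (1 + ε) * ‖v‖) * volume T := by
      rw [← mul_assoc, ← ENNReal.ofReal_mul hc0, mul_assoc c]
    _ ≤ ENNReal.ofReal (4 * ‖v‖ - 2 * Real.pi * ε * ‖v‖) * volume T := by
      gcongr
      nlinarith
    _ ≤ (∫⁻ φ in Ico 0 (2 * Real.pi), ENNReal.ofReal (|normalCoord φ v| - ε * ‖v‖)) *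
          volume T := by gcongr
    _ ≤ ∫⁻ φ in Ico 0 (2 * Real.pi),
          ENNReal.ofReal (|normalCoord φ v| - ε * ‖v‖) * volume T := by
      refine lintegral_mul_const_le _ _
    _ ≤ ∫⁻ φ in Ico 0 (2 * Real.pi), volume (Prod.mk φ ⁻¹' linesMeeting (f '' T)) := by
      refine lintegral_mono fun φ => ?_
      rw [section_linesMeeting]
      exact hsec φ
    _ ≤ _ := lintegral_section_le_kinematicMeasure _

/-- The image of the set of critical points of a curve has zero length. -/
lemma hausdorffMeasure_image_eq_zero_of_hasDerivWithinAt_zero {f : ℝ → Plane} {s : Set ℝ}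
    (hf : ∀ x ∈ s, HasDerivWithinAt f 0 s x) : μH[1] (f '' s) = 0 := by
  have hbdd : ∀ n : ℕ, μH[1] (f '' (s ∩ Icc (-n) n)) = 0 := by
    intro n
    -- A zero derivative makes `f` ε-Lipschitz on each of countably many disjoint pieces, so the
    -- total image length in the window is at most ε times the length of the window.
    have hle : ∀ ε : ℝ≥0, ε ≠ 0 → μH[1] (f '' (s ∩ Icc (-n) n)) ≤ ε * volume (Icc (-n : ℝ) n) := by
      intro ε hε
      obtain ⟨t, A, hd, ht, hst, happ, hA⟩ :=
        exists_partition_approximatesLinearOn_of_hasFDerivWithinAt f s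
          (fun _ => (0 : ℝ →L[ℝ] Plane)) (fun x hx => by
            have := (hf x hx).hasFDerivWithinAt; simpa using this) (fun _ => ε) (fun _ => hε)
      have hcov : f '' (s ∩ Icc (-n) n) ⊆ ⋃ k, f '' (s ∩ t k ∩ Icc (-n) n) := by
        rintro _ ⟨x, ⟨hx, hx'⟩, rfl⟩
        obtain ⟨k, hk⟩ := mem_iUnion.1 (hst hx)
        exact mem_iUnion.2 ⟨k, x, ⟨⟨hx, hk⟩, hx'⟩, rfl⟩
      calc μH[1] (f '' (s ∩ Icc (-n) n)) ≤ μH[1] (⋃ k, f '' (s ∩ t k ∩ Icc (-n) n)) :=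
            measure_mono hcov
        _ ≤ ∑' k, μH[1] (f '' (s ∩ t k ∩ Icc (-n) n)) := measure_iUnion_le _
        _ ≤ ∑' k, ε * volume (t k ∩ Icc (-n) n) := by
          refine ENNReal.tsum_le_tsum fun k => ?_
          rcases s.eq_empty_or_nonempty with rfl | hs
          · simp
          obtain ⟨y, -, hy⟩ := hA hs k
          have hlip : LipschitzOnWith ε f (s ∩ t k ∩ Icc (-n) n) := by
            apply LipschitzOnWith.of_dist_le_mul
            intro x hx z hz
            have := happ k x hx.1 z hz.1
            rw [hy] at this
            simpa [dist_eq_norm] using this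
          have := hlip.hausdorffMeasure_image_le zero_le_one
          rw [hausdorffMeasure_real, ENNReal.rpow_one] at this
          refine this.trans ?_
          gcongr
          exact inter_subset_right
        _ = ε * volume (⋃ k, t k ∩ Icc (-n : ℝ) n) := by
          rw [ENNReal.tsum_mul_left, measure_iUnion]
          · exact fun i j hij => (hd hij).mono inter_subset_left inter_subset_left
          · exact fun k => (ht k).inter measurableSet_Icc
        _ ≤ ε * volume (Icc (-n : ℝ) n) := by
          gcongr
          exact iUnion_subset fun k => inter_subset_right
    refine le_antisymm (ENNReal.le_of_forall_pos_le_add fun δ hδ _ => ?_) zero_le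
    rw [zero_add]
    -- The window has length 2n; the added 1 keeps the quotient meaningful for n = 0.
    have hpos : (0 : ℝ) < δ / (2 * n + 1) := by positivity
    refine (hle (Real.toNNReal (δ / (2 * n + 1))) (Real.toNNReal_pos.2 hpos).ne').trans ?_
    rw [Real.volume_Icc, ← ENNReal.ofReal_coe_nnreal (p := δ)]
    change ENNReal.ofReal _ * _ ≤ _
    rw [← ENNReal.ofReal_mul hpos.le]
    apply ENNReal.ofReal_le_ofReal
    rw [div_mul_eq_mul_div, div_le_iff₀ (by positivity)]
    nlinarith [δ.coe_nonneg]
  refine measure_mono_null ?_ (measure_iUnion_null hbdd)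
  rintro _ ⟨x, hx, rfl⟩
  obtain ⟨n, hn⟩ := exists_nat_ge |x|
  exact mem_iUnion.2 ⟨n, x, ⟨hx, abs_le.1 hn⟩, rfl⟩

/-- A Lipschitz curve is, up to a set of zero length, a countable union of almost linear pieces. -/
lemma exists_almost_linear_cover {f : ℝ → Plane} {K : ℝ≥0} (hf : LipschitzWith K f) {c : ℝ}
    (hc0 : 0 ≤ c) (hc : c < 4) :
    ∃ B : ℕ → Set Plane, (∀ k, MeasurableSet (B k)) ∧ μH[1] (range f \ ⋃ k, B k) = 0 ∧
      ∀ k, ∀ A ⊆ B k, ENNReal.ofReal c * μH[1] A ≤ kinematicMeasure (linesMeeting A) := by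
  classical
  obtain ⟨ε, hε0, hε1, hεc⟩ : ∃ ε : ℝ, 0 < ε ∧ ε < 1 ∧ c * (1 + ε) ≤ 4 - 2 * Real.pi * ε := by
    have hpi := Real.pi_pos
    have hden : 0 < c + 2 * Real.pi := by positivity
    -- This ε solves c(1 + ε) = 4 - 2πε.
    refine ⟨(4 - c) / (c + 2 * Real.pi), div_pos (by linarith) hden,
      (div_lt_one hden).2 (by linarith [Real.pi_gt_three]), le_of_eq ?_⟩
    field_simp
    ring
  set s : Set ℝ := {x | DifferentiableAt ℝ f x ∧ deriv f x ≠ 0} with hs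
  have hsm : MeasurableSet s :=
    (measurableSet_of_differentiableAt ℝ f).inter
      (measurable_deriv f (measurableSet_singleton (0 : Plane)).compl)
  obtain ⟨t, A, hd, ht, hst, happ, hA⟩ :=
    exists_partition_approximatesLinearOn_of_hasFDerivWithinAt f s (fun x => fderiv ℝ f x)
      (fun x hx => hx.1.hasFDerivAt.hasFDerivWithinAt)
      -- The tolerance must be nonzero for every linear map, hence the arbitrary value 1. On
      -- nonempty pieces it is never used: there `A k` is the derivative at a point of `s`, hence
      -- nonzero.
      (fun A => if A 1 = 0 then 1 else Real.toNNReal (ε * ‖A 1‖)) (fun A => by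
        split_ifs with h
        · exact one_ne_zero
        · exact (Real.toNNReal_pos.2 (mul_pos hε0 (norm_pos_iff.2 h))).ne')
  have happ' : ∀ k, ∀ x ∈ s ∩ t k, ∀ y ∈ s ∩ t k,
      A k 1 ≠ 0 ∧ ‖f x - f y - (x - y) • A k 1‖ ≤ ε * ‖A k 1‖ * |x - y| := by
    intro k x hx y hy
    obtain ⟨z, hz, hAz⟩ := hA ⟨x, hx.1⟩ k
    have h0 : A k 1 ≠ 0 := by rw [hAz, fderiv_apply_one_eq_deriv]; exact hz.2
    refine ⟨h0, ?_⟩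
    have := happ k x hx y hy
    rw [if_neg h0, Real.coe_toNNReal _ (by positivity)] at this
    rw [← map_smul, smul_eq_mul, mul_one, ← Real.norm_eq_abs]
    exact this
  refine ⟨fun k => f '' (s ∩ t k), fun k => ?_, ?_, fun k B hB => ?_⟩
  · refine (hsm.inter (ht k)).image_of_continuousOn_injOn hf.continuous.continuousOn ?_
    intro x hx y hy hxy
    obtain ⟨h0, h1⟩ := happ' k x hx y hy
    rw [hxy, sub_self, zero_sub, norm_neg, norm_smul, Real.norm_eq_abs] at h1
    have hpos := norm_pos_iff.2 h0
    have : |x - y| ≤ 0 := by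
      by_contra! h'
      nlinarith [mul_pos hpos h']
    exact sub_eq_zero.1 (abs_nonpos_iff.1 this)
  · have hnd : μH[1] (f '' {x | ¬ DifferentiableAt ℝ f x}) = 0 := by
      have h1 := hf.hausdorffMeasure_image_le zero_le_one {x | ¬ DifferentiableAt ℝ f x}
      rw [hausdorffMeasure_real, ae_iff.1 hf.ae_differentiableAt_real, mul_zero] at h1
      exact le_antisymm h1 zero_le
    have hcrit : μH[1] (f '' {x | DifferentiableAt ℝ f x ∧ deriv f x = 0}) = 0 :=
      hausdorffMeasure_image_eq_zero_of_hasDerivWithinAt_zero fun x hx => by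
        have := hx.1.hasDerivAt
        rw [hx.2] at this
        exact this.hasDerivWithinAt
    refine measure_mono_null ?_ (measure_union_null hnd hcrit)
    rintro _ ⟨⟨x, rfl⟩, hx⟩
    by_cases h1 : DifferentiableAt ℝ f x
    · by_cases h2 : deriv f x = 0
      · exact Or.inr ⟨x, ⟨h1, h2⟩, rfl⟩
      · obtain ⟨k, hk⟩ := mem_iUnion.1 (hst (⟨h1, h2⟩ : x ∈ s))
        exact (hx (mem_iUnion.2 ⟨k, x, ⟨⟨h1, h2⟩, hk⟩, rfl⟩)).elim
    · exact Or.inl ⟨x, h1, rfl⟩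
  · exact mul_hausdorffMeasure_le_kinematicMeasure_of_almost_linear hε0.le
      (fun x hx y hy => (happ' k x hx y hy).2) hc0 hεc hB

/-- Disjoint pieces met by the same line provide distinct intersection points, each counted at least
once. -/
lemma tsum_linesMeeting_le_intersectionNumber {θ : Plane → ℕ} {K : ℕ → Set Plane}
    (hd : Pairwise (Function.onFun Disjoint K)) (hK : ∀ k, ∀ x ∈ K k, θ x ≠ 0) (q : ℝ × ℝ) :
    ∑' k, (linesMeeting (K k)).indicator 1 q ≤ intersectionNumber θ q := by
  have hx : ∀ k : {k | q ∈ linesMeeting (K k)}, ∃ x ∈ K k, normalCoord q.1 x = q.2 := fun k => k.2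
  choose x hxK hxq using hx
  have hinj : Function.Injective fun k => (⟨x k, hxq k⟩ : lineOf q) := by
    intro i j hij
    have hij' : x i = x j := congrArg Subtype.val hij
    by_contra hne
    have := hd (fun h => hne (Subtype.ext h) : (i : ℕ) ≠ j)
    exact disjoint_left.1 this (hxK i) (hij' ▸ hxK j)
  calc ∑' k, (linesMeeting (K k)).indicator (1 : ℝ × ℝ → ℝ≥0∞) q
      = ∑' k, {k | q ∈ linesMeeting (K k)}.indicator (fun _ => (1 : ℝ≥0∞)) k := by
        refine tsum_congr fun k => ?_
        by_cases h : q ∈ linesMeeting (K k) <;> simp [h]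
    _ = ∑' k : {k | q ∈ linesMeeting (K k)}, (1 : ℝ≥0∞) := (tsum_subtype _ _).symm
    _ ≤ ∑' k : {k | q ∈ linesMeeting (K k)}, (θ (x k) : ℝ≥0∞) := by
        refine ENNReal.tsum_le_tsum fun k => ?_
        exact_mod_cast Nat.one_le_iff_ne_zero.2 (hK k _ (hxK k))
    _ ≤ intersectionNumber θ q :=
        ENNReal.tsum_comp_le_tsum_of_injective hinj fun y : lineOf q => (θ y : ℝ≥0∞)

lemma IsOneRectifiable.mono {S T : Set Plane} (hS : IsOneRectifiable S) (hTS : T ⊆ S)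
    (hT : NullMeasurableSet T (μH[1])) : IsOneRectifiable T := by
  obtain ⟨-, f, hf, h0⟩ := hS
  exact ⟨hT, f, hf, measure_mono_null (sdiff_subset_sdiff_left hTS) h0⟩

/-- Half of Crofton's formula, for sets. -/
lemma four_mul_hausdorffMeasure_le_lintegral {A : Set Plane} (hA : IsOneRectifiable A)
    (hfin : μH[1] A ≠ ⊤) {θ : Plane → ℕ} (hθ : ∀ x ∈ A, θ x ≠ 0) :
    4 * μH[1] A ≤ ∫⁻ q, intersectionNumber θ q ∂kinematicMeasure := by
  have main : ∀ c : ℝ, 0 ≤ c → c < 4 →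
      ENNReal.ofReal c * μH[1] A ≤ ∫⁻ q, intersectionNumber θ q ∂kinematicMeasure := by
    intro c hc0 hc
    obtain ⟨hAm, f, hf, h0⟩ := hA
    choose L hL using hf
    choose B hBm hB0 hB using fun i => exists_almost_linear_cover (hL i) hc0 hc
    let B' : ℕ → Set Plane := fun n => B n.unpair.1 n.unpair.2
    have hB'm : ∀ n, MeasurableSet (B' n) := fun n => hBm _ _
    have hcov : μH[1] (A \ ⋃ n, B' n) = 0 := by
      refine measure_mono_null ?_ (measure_union_null h0 (measure_iUnion_null hB0))
      intro x ⟨hx, hx'⟩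
      by_cases h : x ∈ ⋃ i, range (f i)
      · obtain ⟨i, hi⟩ := mem_iUnion.1 h
        refine Or.inr (mem_iUnion.2 ⟨i, hi, fun h' => hx' ?_⟩)
        obtain ⟨k, hk⟩ := mem_iUnion.1 h'
        exact mem_iUnion.2 ⟨Nat.pair i k, by simpa [B'] using hk⟩
      · exact Or.inl ⟨hx, h⟩
    have hDm : ∀ n, MeasurableSet (disjointed B' n) := fun n => MeasurableSet.disjointed hB'm n
    have hADm : ∀ n, NullMeasurableSet (A ∩ disjointed B' n) (μH[1]) := fun n =>
      hAm.inter (hDm n).nullMeasurableSet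
    have hADfin : ∀ n, μH[1] (A ∩ disjointed B' n) ≠ ⊤ := fun n =>
      ne_top_of_le_ne_top hfin (measure_mono inter_subset_left)
    -- Passing to σ-compact cores makes the line sets measurable, so that the sum and the integral
    -- below can be exchanged.
    choose K hKA hK hK0 using fun n => exists_isSigmaCompact_subset (hADm n) (hADfin n)
    have hd : Pairwise (Function.onFun Disjoint K) := fun i j hij =>
      (disjoint_disjointed B' hij).mono ((hKA i).trans inter_subset_right)
        ((hKA j).trans inter_subset_right)
    have hAle : μH[1] A ≤ ∑' n, μH[1] (K n) := by
      calc μH[1] A ≤ μH[1] ((⋃ n, K n) ∪ ((A \ ⋃ n, B' n) ∪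
              ⋃ n, (A ∩ disjointed B' n) \ K n)) := by
            refine measure_mono fun x hx => ?_
            by_cases h : x ∈ ⋃ n, B' n
            · rw [← iUnion_disjointed] at h
              obtain ⟨n, hn⟩ := mem_iUnion.1 h
              by_cases h' : x ∈ K n
              · exact Or.inl (mem_iUnion.2 ⟨n, h'⟩)
              · exact Or.inr (Or.inr (mem_iUnion.2 ⟨n, ⟨hx, hn⟩, h'⟩))
            · exact Or.inr (Or.inl ⟨hx, h⟩)
        _ ≤ μH[1] (⋃ n, K n) + 0 := by
            refine (measure_union_le _ _).trans ?_
            gcongr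
            exact (measure_union_null hcov (measure_iUnion_null hK0)).le
        _ ≤ ∑' n, μH[1] (K n) := by
            rw [add_zero]; exact measure_iUnion_le _
    calc ENNReal.ofReal c * μH[1] A ≤ ENNReal.ofReal c * ∑' n, μH[1] (K n) := by gcongr
      _ = ∑' n, ENNReal.ofReal c * μH[1] (K n) := ENNReal.tsum_mul_left.symm
      _ ≤ ∑' n, kinematicMeasure (linesMeeting (K n)) :=
          ENNReal.tsum_le_tsum fun n => hB _ _ _
            ((hKA n).trans (inter_subset_right.trans (disjointed_subset B' n)))
      _ = ∑' n, ∫⁻ q, (linesMeeting (K n)).indicator 1 q ∂kinematicMeasure := by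
          refine tsum_congr fun n => ?_
          rw [lintegral_indicator_one (measurableSet_linesMeeting (hK n))]
      _ = ∫⁻ q, ∑' n, (linesMeeting (K n)).indicator 1 q ∂kinematicMeasure :=
          (lintegral_tsum fun n =>
            (measurable_one.indicator (measurableSet_linesMeeting (hK n))).aemeasurable).symm
      _ ≤ _ := lintegral_mono fun q => tsum_linesMeeting_le_intersectionNumber hd
          (fun k x hx => hθ x (hKA k hx).1) q
  -- Each c < 4 needed its own decomposition, but the resulting inequality passes to the limit
  -- because `A` has finite length.
  have hlim : Tendsto (fun c : ℝ => ENNReal.ofReal c * μH[1] A) (𝓝[<] 4)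
      (𝓝 (ENNReal.ofReal 4 * μH[1] A)) := by
    refine ENNReal.Tendsto.mul_const ?_ (Or.inr hfin)
    exact (ENNReal.continuous_ofReal.tendsto 4).mono_left nhdsWithin_le_nhds
  rw [show (4 : ℝ≥0∞) = ENNReal.ofReal 4 by simp]
  refine le_of_tendsto hlim ?_
  filter_upwards [Ioo_mem_nhdsLT (show (0 : ℝ) < 4 by norm_num)] with c hc
  exact main c hc.1.le hc.2

/-- Each lower integral is attained by a measurable minorant, so this direction needs no
measurability. It is applied to intersection numbers of arbitrary superlevel sets. -/
lemma tsum_lintegral_le_lintegral_tsum {α : Type*} [MeasurableSpace α] (μ : Measure α)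
    (f : ℕ → α → ℝ≥0∞) : ∑' n, ∫⁻ a, f n a ∂μ ≤ ∫⁻ a, ∑' n, f n a ∂μ := by
  choose g hg hgf hint using fun n => exists_measurable_le_lintegral_eq μ (f n)
  simp only [hint]
  rw [← lintegral_tsum fun n => (hg n).aemeasurable]
  exact lintegral_mono fun a => ENNReal.tsum_le_tsum fun n => hgf n a

lemma natCast_eq_tsum_indicator (m : ℕ) :
    (m : ℝ≥0∞) = ∑' k : ℕ, (if k < m then 1 else 0 : ℝ≥0∞) := by
  rw [tsum_eq_sum (s := Finset.range m) (fun k hk => by simpa using hk)]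
  rw [Finset.sum_congr rfl fun k hk => if_pos (Finset.mem_range.1 hk)]
  simp

/-- The indicator function of a set, as a multiplicity function. -/
def multiplicityOne (A : Set Plane) : Plane → ℕ := A.indicator 1

lemma natCast_eq_tsum_multiplicityOne (θ : Plane → ℕ) (x : Plane) :
    (θ x : ℝ≥0∞) = ∑' k : ℕ, (multiplicityOne {y | k < θ y} x : ℝ≥0∞) := by
  rw [natCast_eq_tsum_indicator]
  refine tsum_congr fun k => ?_
  by_cases h : k < θ x <;> simp [multiplicityOne, h]

/-- Half of Crofton's formula, for sets with multiplicity. -/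
lemma four_mul_multisetLength_le_lintegral {θ : Plane → ℕ} (hθ : IsOneRectifiableMultiset θ)
    (hfin : multisetLength θ ≠ ⊤) :
    4 * multisetLength θ ≤ ∫⁻ q, intersectionNumber θ q ∂kinematicMeasure := by
  have hm : ∀ k, NullMeasurableSet {y | k < θ y} (μH[1] : Measure Plane) := fun k =>
    hθ.1 (measurableSet_Ioi (a := k))
  -- Layer-cake decomposition: both length and intersection number are sums over the superlevel sets
  -- of θ, which reduces the claim to sets without multiplicity.
  have hlen : multisetLength θ = ∑' k, μH[1] {y | k < θ y} := by
    unfold multisetLength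
    simp_rw [natCast_eq_tsum_multiplicityOne θ]
    have hcast : ∀ k x, ((multiplicityOne {y | k < θ y} x : ℕ) : ℝ≥0∞) =
        {y | k < θ y}.indicator 1 x := fun k x => by
      by_cases h : k < θ x <;> simp [multiplicityOne, h]
    simp_rw [hcast]
    rw [lintegral_tsum]
    · exact tsum_congr fun k => lintegral_indicator_one₀ (hm k)
    · exact fun k => aemeasurable_const.indicator₀ (hm k)
  have hsum : ∀ q, intersectionNumber θ q =
      ∑' k, intersectionNumber (multiplicityOne {y | k < θ y}) q := fun q => by
    unfold intersectionNumber
    simp_rw [natCast_eq_tsum_multiplicityOne θ]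
    exact ENNReal.tsum_comm
  simp_rw [hsum]
  rw [hlen, ← ENNReal.tsum_mul_left]
  refine le_trans (ENNReal.tsum_le_tsum fun k => ?_) (tsum_lintegral_le_lintegral_tsum _ _)
  refine four_mul_hausdorffMeasure_le_lintegral (hθ.2.mono (fun y hy => ?_) (hm k)) ?_ ?_
  · exact (Nat.zero_le k |>.trans_lt hy).ne'
  · rw [hlen] at hfin
    exact ENNReal.ne_top_of_tsum_ne_top hfin k
  · intro x hx
    simp [multiplicityOne, indicator_of_mem hx]

/-! ### Convex domains: gauge and boundary curve -/

/-- A bounded convex open set. -/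
structure IsConvexDomain (Ω : Set Plane) : Prop where
  isOpen : IsOpen Ω
  isBounded : Bornology.IsBounded Ω
  convex : Convex ℝ Ω

/-- The gauge of `Ω` with respect to the centre `c`. -/
def gaugeAt (Ω : Set Plane) (c : Plane) (v : Plane) : ℝ := gauge ((c + ·) ⁻¹' Ω) v

lemma norm_unitVec (t : ℝ) : ‖unitVec t‖ = 1 := by
  have h : ‖unitVec t‖ ^ 2 = 1 := by rw [Plane.norm_sq]; simp
  exact (sq_eq_sq₀ (norm_nonneg _) zero_le_one).1 (by rw [h, one_pow])

/-- The boundary point of `Ω` seen from `c` in direction `v`. -/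
def radialPoint (Ω : Set Plane) (c v : Plane) : Plane := c + (gaugeAt Ω c v)⁻¹ • v

/-- The parametrization of the boundary of `Ω` by the angle at `c`. -/
def boundaryCurve (Ω : Set Plane) (c : Plane) (t : ℝ) : Plane := radialPoint Ω c (unitVec t)

lemma unitVec_ne_zero (t : ℝ) : unitVec t ≠ 0 := by
  intro h; have := norm_unitVec t; simp [h] at this

lemma unitVec_periodic : Function.Periodic unitVec (2 * Real.pi) := fun t => by
  simp [unitVec]

lemma lipschitzWith_unitVec : LipschitzWith 1 unitVec := by
  apply LipschitzWith.of_dist_le_mul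
  intro s t
  rw [NNReal.coe_one, one_mul, dist_eq_norm, Real.dist_eq]
  apply le_of_sq_le_sq _ (abs_nonneg _)
  rw [Plane.norm_sq, sq_abs]
  simp only [PiLp.sub_apply, unitVec_zero_apply, unitVec_one_apply]
  have h1 := Real.one_sub_sq_div_two_le_cos (x := s - t)
  rw [Real.cos_sub] at h1
  nlinarith [Real.sin_sq_add_cos_sq s, Real.sin_sq_add_cos_sq t]

lemma eq_of_unitVec_eq {s t : ℝ} (hs : s ∈ Ico 0 (2 * Real.pi)) (ht : t ∈ Ico 0 (2 * Real.pi))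
    (h : unitVec s = unitVec t) : s = t := by
  have h0 : Real.cos s = Real.cos t := congrArg (fun v : Plane => v 0) h
  have h1 : Real.sin s = Real.sin t := congrArg (fun v : Plane => v 1) h
  have h2 : Real.cos (s - t) = 1 := by
    rw [Real.cos_sub, h0, h1, ← sq, ← sq, Real.cos_sq_add_sin_sq]
  exact sub_eq_zero.1 ((Real.cos_eq_one_iff_of_lt_of_lt (by linarith [hs.1, ht.2])
    (by linarith [hs.2, ht.1])).1 h2)

namespace IsConvexDomain

variable {Ω : Set Plane} {c : Plane}

lemma isOpen_translate (h : IsConvexDomain Ω) (c : Plane) : IsOpen ((c + ·) ⁻¹' Ω) :=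
  h.isOpen.preimage (continuous_const_add c)

lemma convex_translate (h : IsConvexDomain Ω) (c : Plane) : Convex ℝ ((c + ·) ⁻¹' Ω) :=
  h.convex.translate_preimage_right c

lemma translate_mem_nhds (h : IsConvexDomain Ω) (hc : c ∈ Ω) : (c + ·) ⁻¹' Ω ∈ 𝓝 (0 : Plane) :=
  (h.isOpen_translate c).mem_nhds (by simpa using hc)

lemma isBounded_translate (h : IsConvexDomain Ω) (c : Plane) :
    Bornology.IsBounded ((c + ·) ⁻¹' Ω) := by
  obtain ⟨R, hR⟩ := h.isBounded.exists_norm_le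
  refine isBounded_iff_forall_norm_le.2 ⟨R + ‖c‖, fun x hx => ?_⟩
  have h1 := hR _ hx
  have h2 := norm_sub_le (c + x) c
  rw [add_sub_cancel_left] at h2
  linarith

lemma gaugeAt_pos (h : IsConvexDomain Ω) (hc : c ∈ Ω) {v : Plane} (hv : v ≠ 0) :
    0 < gaugeAt Ω c v :=
  (gauge_pos (absorbent_nhds_zero (h.translate_mem_nhds hc))
    ((NormedSpace.isVonNBounded_iff ℝ).2 (h.isBounded_translate c))).2 hv

lemma gaugeAt_smul {a : ℝ} (ha : 0 ≤ a) (v : Plane) :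
    gaugeAt Ω c (a • v) = a * gaugeAt Ω c v :=
  gauge_smul_of_nonneg ha v

lemma gaugeAt_eq_one_iff (h : IsConvexDomain Ω) (hc : c ∈ Ω) (v : Plane) :
    gaugeAt Ω c v = 1 ↔ c + v ∈ frontier Ω := by
  rw [gaugeAt, gauge_eq_one_iff_mem_frontier (h.convex_translate c) (h.translate_mem_nhds hc),
    ← (isOpenMap_add_left c).preimage_frontier_eq_frontier_preimage (continuous_const_add c)]
  rfl

lemma radialPoint_mem_frontier (h : IsConvexDomain Ω) (hc : c ∈ Ω) {v : Plane} (hv : v ≠ 0) :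
    radialPoint Ω c v ∈ frontier Ω := by
  have hp := h.gaugeAt_pos hc hv
  rw [radialPoint, ← h.gaugeAt_eq_one_iff hc, gaugeAt_smul (inv_nonneg.2 hp.le),
    inv_mul_cancel₀ hp.ne']

/-- A line through a point of `Ω` meets the boundary in exactly two points. -/
lemma exists_lineOf_inter_frontier_eq (h : IsConvexDomain Ω) {q : ℝ × ℝ}
    (hq : q ∈ linesMeeting Ω) :
    ∃ y z, y ≠ z ∧ lineOf q ∩ frontier Ω = {y, z} := by
  obtain ⟨x, hx, hxq⟩ := hq
  -- `w` spans the direction of the line. From the interior point `x` each of the two rays ±w leaves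
  -- the domain exactly once, where the gauge centred at `x` equals 1.
  set w : Plane := !₂[-Real.sin q.1, Real.cos q.1] with hw
  have hw0 : w 0 = -Real.sin q.1 := rfl
  have hw1 : w 1 = Real.cos q.1 := rfl
  have hcs := Real.sin_sq_add_cos_sq q.1
  have hwn : normalCoord q.1 w = 0 := by rw [normalCoord, hw0, hw1]; ring
  have hwne : w ≠ 0 := by
    intro h0
    have := Plane.norm_sq w
    rw [hw0, hw1, h0, norm_zero] at this
    nlinarith
  have hpos := h.gaugeAt_pos hx hwne
  have hneg := h.gaugeAt_pos hx (neg_ne_zero.2 hwne)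
  have hline : ∀ y, y ∈ lineOf q ↔ ∃ t : ℝ, y = x + t • w := by
    intro y
    rw [mem_lineOf, ← hxq]
    constructor
    · intro hy
      refine ⟨(y 1 - x 1) * Real.cos q.1 - (y 0 - x 0) * Real.sin q.1, ?_⟩
      simp only [normalCoord] at hy
      ext i
      fin_cases i
      · simp [hw0]
        linear_combination (x 0 - y 0) * hcs + Real.cos q.1 * hy
      · simp [hw1]
        linear_combination (x 1 - y 1) * hcs + Real.sin q.1 * hy
    · rintro ⟨t, rfl⟩
      rw [normalCoord_add, normalCoord_smul, hwn]; ring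
  refine ⟨radialPoint Ω x w, radialPoint Ω x (-w), ?_, ?_⟩
  · intro he
    rw [radialPoint, radialPoint, add_right_inj, smul_neg, ← add_eq_zero_iff_eq_neg, ← add_smul,
      smul_eq_zero] at he
    have := inv_pos.2 hpos
    have := inv_pos.2 hneg
    rcases he with he | he
    · linarith
    · exact hwne he
  · ext y
    simp only [mem_inter_iff, mem_insert_iff, mem_singleton_iff]
    constructor
    · rintro ⟨hy, hyf⟩
      obtain ⟨t, rfl⟩ := (hline y).1 hy
      rw [← h.gaugeAt_eq_one_iff hx] at hyf
      rcases le_total 0 t with ht | ht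
      · left
        rw [gaugeAt_smul ht] at hyf
        rw [radialPoint, ← eq_inv_of_mul_eq_one_left hyf]
      · right
        rw [← neg_smul_neg, gaugeAt_smul (neg_nonneg.2 ht)] at hyf
        rw [radialPoint, ← eq_inv_of_mul_eq_one_left hyf, neg_smul_neg]
    · rintro (rfl | rfl)
      · exact ⟨(hline _).2 ⟨_, rfl⟩, h.radialPoint_mem_frontier hx hwne⟩
      · exact ⟨(hline _).2 ⟨-(gaugeAt Ω x (-w))⁻¹, by rw [radialPoint, smul_neg, neg_smul]⟩,
          h.radialPoint_mem_frontier hx (neg_ne_zero.2 hwne)⟩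

/-- Almost every line meeting the closure of `Ω` meets `Ω`. -/
lemma ae_mem_linesMeeting (h : IsConvexDomain Ω) :
    ∀ᵐ q ∂kinematicMeasure, q ∈ linesMeeting (closure Ω) → q ∈ linesMeeting Ω := by
  have hm : MeasurableSet (linesMeeting (closure Ω) \ linesMeeting Ω) :=
    (isClosed_linesMeeting h.isBounded.isCompact_closure).measurableSet.diff
      (isOpen_linesMeeting h.isOpen).measurableSet
  have h0 : kinematicMeasure (linesMeeting (closure Ω) \ linesMeeting Ω) = 0 := by
    rw [kinematicMeasure_apply hm]
    refine (lintegral_congr fun φ => ?_).trans lintegral_zero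
    -- For a fixed direction, the exceptional offsets lie in the frontier of the projection of `Ω`,
    -- a convex subset of the real line, and this frontier is null.
    have hI : Convex ℝ (normalCoord φ '' Ω) := h.convex.linear_image (normalCoordLin φ)
    refine measure_mono_null ?_ (hI.addHaar_frontier volume)
    rw [preimage_sdiff, section_linesMeeting, section_linesMeeting]
    exact sdiff_subset_sdiff (image_closure_subset_closure_image
      (lipschitzWith_normalCoord φ).continuous) interior_subset
  rw [ae_iff]
  refine measure_mono_null (fun q hq => ?_) h0
  simpa [Classical.not_imp] using hq

lemma boundaryCurve_mem_frontier (h : IsConvexDomain Ω) (hc : c ∈ Ω) (t : ℝ) :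
    boundaryCurve Ω c t ∈ frontier Ω := h.radialPoint_mem_frontier hc (unitVec_ne_zero t)

lemma boundaryCurve_periodic : Function.Periodic (boundaryCurve Ω c) (2 * Real.pi) := fun t => by
  rw [boundaryCurve, boundaryCurve, unitVec_periodic t]

lemma image_boundaryCurve (h : IsConvexDomain Ω) (hc : c ∈ Ω) :
    boundaryCurve Ω c '' Ico 0 (2 * Real.pi) = frontier Ω := by
  apply Subset.antisymm
  · rintro _ ⟨t, -, rfl⟩
    exact h.boundaryCurve_mem_frontier hc t
  · intro y hy
    have hy' : c + (y - c) ∈ frontier Ω := by rwa [add_sub_cancel]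
    rw [← h.gaugeAt_eq_one_iff hc] at hy'
    obtain ⟨t, ht⟩ := exists_eq_norm_smul_unitVec (y - c)
    obtain ⟨s, hs, hst⟩ := (boundaryCurve_periodic (Ω := Ω) (c := c)).exists_mem_Ico₀
      Real.two_pi_pos t
    refine ⟨s, hs, ?_⟩
    rw [← hst, boundaryCurve, radialPoint]
    rw [ht, gaugeAt_smul (norm_nonneg _)] at hy'
    rw [← eq_inv_of_mul_eq_one_left hy', ← ht, add_sub_cancel]

lemma injOn_boundaryCurve (h : IsConvexDomain Ω) (hc : c ∈ Ω) :
    InjOn (boundaryCurve Ω c) (Ico 0 (2 * Real.pi)) := by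
  intro s hs t ht hst
  apply eq_of_unitVec_eq hs ht
  rw [boundaryCurve, boundaryCurve, radialPoint, radialPoint, add_right_inj] at hst
  have h1 := inv_pos.2 (h.gaugeAt_pos hc (unitVec_ne_zero s))
  have h2 := inv_pos.2 (h.gaugeAt_pos hc (unitVec_ne_zero t))
  have h3 := congrArg norm hst
  rw [norm_smul, norm_smul, norm_unitVec, norm_unitVec, mul_one, mul_one,
    Real.norm_of_nonneg h1.le, Real.norm_of_nonneg h2.le] at h3
  rw [h3] at hst
  exact smul_right_injective Plane h2.ne' hst

/-- The gauge is Lipschitz, and on unit vectors it is bounded below because the domain is bounded.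
Hence its reciprocal, the radial distance to the boundary, is bounded and Lipschitz in the angle. -/
lemma exists_lipschitzWith_boundaryCurve (h : IsConvexDomain Ω) (hc : c ∈ Ω) :
    ∃ K, LipschitzWith K (boundaryCurve Ω c) := by
  obtain ⟨K, hK⟩ := (h.convex_translate c).lipschitz_gauge (h.translate_mem_nhds hc)
  have hg : ∀ s t, |gaugeAt Ω c (unitVec s) - gaugeAt Ω c (unitVec t)| ≤ K * |s - t| := by
    intro s t
    have := (hK.comp lipschitzWith_unitVec).dist_le_mul s t
    simpa [Real.dist_eq, gaugeAt] using this
  obtain ⟨R, hR0, hR⟩ := (h.isBounded_translate c).subset_ball_lt 0 0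
  have hlow : ∀ t, R⁻¹ ≤ gaugeAt Ω c (unitVec t) := fun t => by
    have := le_gauge_of_subset_closedBall (absorbent_nhds_zero (h.translate_mem_nhds hc)) hR0.le
      (hR.trans Metric.ball_subset_closedBall) (x := unitVec t)
    rwa [norm_unitVec, one_div] at this
  have hinv : ∀ t, 0 ≤ (gaugeAt Ω c (unitVec t))⁻¹ ∧ (gaugeAt Ω c (unitVec t))⁻¹ ≤ R := fun t =>
    ⟨inv_nonneg.2 ((inv_pos.2 hR0).le.trans (hlow t)),
      inv_le_of_inv_le₀ hR0 (hlow t)⟩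
  refine ⟨Real.toNNReal (R * R * K + R), LipschitzWith.of_dist_le_mul fun s t => ?_⟩
  rw [Real.coe_toNNReal _ (by positivity), dist_eq_norm, Real.dist_eq, boundaryCurve, boundaryCurve,
    radialPoint, radialPoint, add_sub_add_left_eq_sub]
  set a := gaugeAt Ω c (unitVec s) with ha
  set b := gaugeAt Ω c (unitVec t) with hb
  have ha0 : 0 < a := h.gaugeAt_pos hc (unitVec_ne_zero s)
  have hb0 : 0 < b := h.gaugeAt_pos hc (unitVec_ne_zero t)
  have hab : |a⁻¹ - b⁻¹| ≤ R * R * (K * |s - t|) := by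
    have : a⁻¹ - b⁻¹ = a⁻¹ * b⁻¹ * (b - a) := by field_simp
    rw [this, abs_mul, abs_mul, abs_of_nonneg (hinv s).1, abs_of_nonneg (hinv t).1, abs_sub_comm]
    have h1 := hinv s
    have h2 := hinv t
    gcongr
    · exact h1.2
    · exact h2.2
    · exact hg s t
  have hu : ‖unitVec s - unitVec t‖ ≤ |s - t| := by
    have := lipschitzWith_unitVec.dist_le_mul s t
    simpa [dist_eq_norm] using this
  have hsplit : a⁻¹ • unitVec s - b⁻¹ • unitVec t =
      (a⁻¹ - b⁻¹) • unitVec s + b⁻¹ • (unitVec s - unitVec t) := by module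
  rw [hsplit]
  refine (norm_add_le _ _).trans ?_
  rw [norm_smul, norm_smul, norm_unitVec, mul_one, Real.norm_eq_abs,
    Real.norm_of_nonneg (hinv t).1]
  have : b⁻¹ * ‖unitVec s - unitVec t‖ ≤ R * |s - t| :=
    mul_le_mul (hinv t).2 hu (norm_nonneg _) hR0.le
  linarith

lemma continuous_boundaryCurve (h : IsConvexDomain Ω) (hc : c ∈ Ω) :
    Continuous (boundaryCurve Ω c) :=
  (h.exists_lipschitzWith_boundaryCurve hc).choose_spec.continuous

end IsConvexDomain

/-! ### Inscribed polygons and the measure of lines meeting the domain -/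

/-- A curve is at least as long as its chord. -/
lemma ofReal_dist_le_hausdorffMeasure_image {γ : ℝ → Plane} (hγ : Continuous γ) {a b : ℝ}
    (hab : a ≤ b) : ENNReal.ofReal (dist (γ a) (γ b)) ≤ μH[1] (γ '' Icc a b) := by
  -- Distance from the starting point does not increase length, and by continuity it takes all
  -- values up to the chord length along the curve.
  have hlip : LipschitzWith 1 fun x => dist x (γ a) := LipschitzWith.dist_left (γ a)
  have h1 := hlip.hausdorffMeasure_image_le zero_le_one (γ '' Icc a b)
  rw [hausdorffMeasure_real, ENNReal.coe_one, ENNReal.one_rpow, one_mul] at h1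
  refine le_trans ?_ h1
  have h2 : Icc (dist (γ a) (γ a)) (dist (γ b) (γ a)) ⊆
      (fun x => dist x (γ a)) '' (γ '' Icc a b) := by
    rw [image_image]
    exact intermediate_value_Icc hab (f := fun t => dist (γ t) (γ a)) (by fun_prop)
  refine le_trans ?_ (measure_mono h2)
  rw [Real.volume_Icc, dist_self, sub_zero, dist_comm]

lemma mul_pos_of_no_sign_change {h : ℕ → ℝ} {a b : ℕ} (hab : a ≤ b) (ha : h a ≠ 0)
    (hh : ∀ k, a ≤ k → k < b → 0 < h k * h (k + 1)) : 0 < h a * h b := by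
  induction b, hab using Nat.le_induction with
  | base => exact mul_self_pos.2 ha
  | succ b hab ih =>
    have h1 := ih fun k hk hkb => hh k hk (hkb.trans (Nat.lt_succ_self b))
    have h2 := hh b hab (Nat.lt_succ_self b)
    have hb : h b ≠ 0 := fun h0 => by simp [h0] at h1
    have h3 : 0 < (h b * h b) * (h a * h (b + 1)) := by
      have := mul_pos h1 h2
      linarith [show h a * h b * (h b * h (b + 1)) = h b * h b * (h a * h (b + 1)) by ring]
    exact (pos_iff_pos_of_mul_pos h3).1 (mul_self_pos.2 hb)

/-- A closed cyclic sequence taking both signs changes sign at least twice. -/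
lemma two_le_card_sign_changes {h : ℕ → ℝ} {N i j : ℕ} (hN : h N = h 0) (hi : i ≤ N) (hj : j ≤ N)
    (hij : h i * h j < 0) :
    2 ≤ ((Finset.range N).filter fun k => h k * h (k + 1) ≤ 0).card := by
  wlog hlt : i ≤ j generalizing i j with H
  · exact H hj hi (by rwa [mul_comm]) (le_of_not_ge hlt)
  have hi0 : h i ≠ 0 := fun h0 => by simp [h0] at hij
  have hj0 : h j ≠ 0 := fun h0 => by simp [h0] at hij
  obtain ⟨k, hik, hkj, hk⟩ : ∃ k, i ≤ k ∧ k < j ∧ h k * h (k + 1) ≤ 0 := by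
    by_contra! hcon
    exact absurd (mul_pos_of_no_sign_change hlt hi0 hcon) hij.not_gt
  -- The second sign change lies on the complementary way round, from `j` through `N` (identified
  -- with 0) to `i`.
  obtain ⟨l, hl, hlN, hl'⟩ : ∃ l, (l < i ∨ j ≤ l) ∧ l < N ∧ h l * h (l + 1) ≤ 0 := by
    by_contra! hcon
    have h1 := mul_pos_of_no_sign_change hj hj0 fun l hl hlN => hcon l (Or.inr hl) hlN
    rw [hN] at h1
    have h00 : h 0 ≠ 0 := fun h0 => by simp [h0] at h1
    have h2 := mul_pos_of_no_sign_change (Nat.zero_le i) h00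
      fun l _ hli => hcon l (Or.inl hli) (hli.trans_le hi)
    have h3 := mul_pos h1 h2
    have h4 : (h 0 * h 0) * (h i * h j) < 0 := mul_neg_of_pos_of_neg (mul_self_pos.2 h00) hij
    linarith [show h j * h 0 * (h 0 * h i) = (h 0 * h 0) * (h i * h j) by ring]
  refine Finset.one_lt_card.2 ⟨k, ?_, l, ?_, by omega⟩
  · simp only [Finset.mem_filter, Finset.mem_range]
    exact ⟨hkj.trans_le hj, hk⟩
  · simp only [Finset.mem_filter, Finset.mem_range]
    exact ⟨hlN, hl'⟩

lemma mem_linesMeeting_segment {q : ℝ × ℝ} {a b : Plane}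
    (h : (normalCoord q.1 a - q.2) * (normalCoord q.1 b - q.2) ≤ 0) :
    q ∈ linesMeeting (segment ℝ a b) := by
  have him : normalCoord q.1 '' segment ℝ a b = segment ℝ (normalCoord q.1 a) (normalCoord q.1 b) :=
    image_segment ℝ (normalCoordLin q.1).toAffineMap a b
  change q.2 ∈ normalCoord q.1 '' segment ℝ a b
  rw [him, segment_eq_uIcc, mem_uIcc]
  rcases mul_nonpos_iff.1 h with ⟨h1, h2⟩ | ⟨h1, h2⟩
  · right; constructor <;> linarith
  · left; constructor <;> linarith

lemma hausdorffMeasure_one_singleton (x : Plane) : μH[1] ({x} : Set Plane) = 0 := by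
  have := Measure.nullSingletonClass_hausdorff Plane (d := 1) one_pos
  exact measure_singleton x

namespace IsConvexDomain

variable {Ω : Set Plane} {c : Plane}

lemma measurableSet_arc (h : IsConvexDomain Ω) (hc : c ∈ Ω) {a b : ℝ} (ha : 0 ≤ a)
    (hb : b ≤ 2 * Real.pi) : MeasurableSet (boundaryCurve Ω c '' Ico a b) :=
  measurableSet_Ico.image_of_continuousOn_injOn (h.continuous_boundaryCurve hc).continuousOn
    ((h.injOn_boundaryCurve hc).mono (Ico_subset_Ico ha hb))

lemma hausdorffMeasure_arc_add (h : IsConvexDomain Ω) (hc : c ∈ Ω) {s t u : ℝ} (hs : 0 ≤ s)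
    (hst : s ≤ t) (htu : t ≤ u) (hu : u ≤ 2 * Real.pi) :
    μH[1] (boundaryCurve Ω c '' Ico s u) =
      μH[1] (boundaryCurve Ω c '' Ico s t) + μH[1] (boundaryCurve Ω c '' Ico t u) := by
  rw [← Ico_union_Ico_eq_Ico hst htu, image_union,
    measure_union _ (h.measurableSet_arc hc (hs.trans hst) hu)]
  exact Ico_disjoint_Ico_same.image (h.injOn_boundaryCurve hc)
    (Ico_subset_Ico hs (htu.trans hu)) (Ico_subset_Ico (hs.trans hst) hu)

lemma ofReal_dist_le_hausdorffMeasure_arc (h : IsConvexDomain Ω) (hc : c ∈ Ω) {a b : ℝ}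
    (hab : a ≤ b) : ENNReal.ofReal (dist (boundaryCurve Ω c a) (boundaryCurve Ω c b)) ≤
      μH[1] (boundaryCurve Ω c '' Ico a b) := by
  refine (ofReal_dist_le_hausdorffMeasure_image (h.continuous_boundaryCurve hc) hab).trans ?_
  rw [← Ico_union_right hab, image_union, image_singleton]
  refine (measure_union_le _ _).trans ?_
  rw [hausdorffMeasure_one_singleton, add_zero]

lemma exists_hausdorffMeasure_arc_le (h : IsConvexDomain Ω) (hc : c ∈ Ω) :
    ∃ K : ℝ≥0, ∀ a b, μH[1] (boundaryCurve Ω c '' Ico a b) ≤ K * ENNReal.ofReal (b - a) := by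
  obtain ⟨K, hK⟩ := h.exists_lipschitzWith_boundaryCurve hc
  refine ⟨K, fun a b => ?_⟩
  have := hK.hausdorffMeasure_image_le zero_le_one (Ico a b)
  rwa [hausdorffMeasure_real, Real.volume_Ico, ENNReal.rpow_one] at this

lemma hausdorffMeasure_frontier_ne_top (h : IsConvexDomain Ω) (hne : Ω.Nonempty) :
    μH[1] (frontier Ω) ≠ ⊤ := by
  obtain ⟨c, hc⟩ := hne
  obtain ⟨K, hK⟩ := h.exists_hausdorffMeasure_arc_le hc
  rw [← h.image_boundaryCurve hc]
  exact ne_top_of_le_ne_top (ENNReal.mul_ne_top ENNReal.coe_ne_top ENNReal.ofReal_ne_top) (hK _ _)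

/-- The lines separating the vertices of an inscribed polygon have measure at most twice the length
of the boundary. -/
lemma two_mul_kinematicMeasure_separating_le (h : IsConvexDomain Ω) (hc : c ∈ Ω) {N : ℕ}
    (hN : 0 < N) {v : ℕ → Plane} (hv : ∀ i : ℕ, v i = boundaryCurve Ω c (2 * Real.pi * i / N)) :
    2 * kinematicMeasure {q | ∃ i ≤ N, ∃ j ≤ N, normalCoord q.1 (v i) < q.2 ∧
      q.2 < normalCoord q.1 (v j)} ≤ 4 * μH[1] (frontier Ω) := by
  have hN' : (0 : ℝ) < N := Nat.cast_pos.2 hN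
  have hpi := Real.pi_pos
  set t : ℕ → ℝ := fun i => 2 * Real.pi * i / N with ht
  have htN : t N = 2 * Real.pi := by simp only [ht]; field_simp
  have ht0 : t 0 = 0 := by simp [ht]
  have htm : Monotone t := fun i j hij => by
    simp only [ht]
    have : (i : ℝ) ≤ j := Nat.cast_le.2 hij
    gcongr
  have hv' : ∀ i, v i = boundaryCurve Ω c (t i) := hv
  have hcyc : v N = v 0 := by
    rw [hv', hv', htN, ht0]
    simpa using boundaryCurve_periodic (Ω := Ω) (c := c) 0
  -- `F` counts the sides of the inscribed closed polygon met by the line. A separating line meets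
  -- at least two, so Markov's inequality bounds the measure by the integral of `F`, which is four
  -- times the perimeter of the polygon.
  let F : ℝ × ℝ → ℝ≥0∞ := fun q =>
    ∑ k ∈ Finset.range N, (linesMeeting (segment ℝ (v k) (v (k + 1)))).indicator 1 q
  have hmeas : ∀ k, MeasurableSet (linesMeeting (segment ℝ (v k) (v (k + 1)))) := fun k =>
    (isClosed_linesMeeting (isCompact_segment _ _)).measurableSet
  have hsub : {q : ℝ × ℝ | ∃ i ≤ N, ∃ j ≤ N, normalCoord q.1 (v i) < q.2 ∧
      q.2 < normalCoord q.1 (v j)} ⊆ {q | 2 ≤ F q} := by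
    rintro q ⟨i, hi, j, hj, h1, h2⟩
    have hcard := two_le_card_sign_changes (h := fun k => normalCoord q.1 (v k) - q.2) (N := N)
      (by simp only [hcyc]) hi hj (mul_neg_of_neg_of_pos (by linarith) (by linarith))
    calc (2 : ℝ≥0∞) ≤ (((Finset.range N).filter fun k => (normalCoord q.1 (v k) - q.2) *
            (normalCoord q.1 (v (k + 1)) - q.2) ≤ 0).card : ℝ≥0∞) := by exact_mod_cast hcard
      _ = ∑ k ∈ Finset.range N, if (normalCoord q.1 (v k) - q.2) *
            (normalCoord q.1 (v (k + 1)) - q.2) ≤ 0 then 1 else 0 := by simp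
      _ ≤ F q := by
        refine Finset.sum_le_sum fun k _ => ?_
        split_ifs with hk
        · rw [indicator_of_mem (mem_linesMeeting_segment hk)]; rfl
        · exact zero_le
  have hint : ∫⁻ q, F q ∂kinematicMeasure =
      ∑ k ∈ Finset.range N, ENNReal.ofReal (4 * dist (v k) (v (k + 1))) := by
    rw [lintegral_finsetSum _ fun k _ => measurable_one.indicator (hmeas k)]
    refine Finset.sum_congr rfl fun k _ => ?_
    rw [lintegral_indicator_one (hmeas k), kinematicMeasure_linesMeeting_segment]
  have hFm : Measurable F :=
    Finset.measurable_fun_sum _ fun k _ => measurable_one.indicator (hmeas k)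
  have hsum : ∀ m ≤ N, ∑ k ∈ Finset.range m, μH[1] (boundaryCurve Ω c '' Ico (t k) (t (k + 1))) =
      μH[1] (boundaryCurve Ω c '' Ico 0 (t m)) := by
    intro m
    induction m with
    | zero => intro _; simp [ht0]
    | succ m ih =>
      intro hm
      rw [Finset.sum_range_succ, ih (by omega), ← h.hausdorffMeasure_arc_add hc le_rfl]
      · rw [← ht0]; exact htm (Nat.zero_le m)
      · exact htm (Nat.le_succ m)
      · rw [← htN]; exact htm hm
  calc 2 * kinematicMeasure {q | ∃ i ≤ N, ∃ j ≤ N, normalCoord q.1 (v i) < q.2 ∧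
        q.2 < normalCoord q.1 (v j)}
      ≤ 2 * kinematicMeasure {q | 2 ≤ F q} := by gcongr
    _ ≤ ∫⁻ q, F q ∂kinematicMeasure := mul_meas_ge_le_lintegral hFm 2
    _ = 4 * ∑ k ∈ Finset.range N, ENNReal.ofReal (dist (v k) (v (k + 1))) := by
      rw [hint, Finset.mul_sum]
      refine Finset.sum_congr rfl fun k _ => ?_
      rw [ENNReal.ofReal_mul (by norm_num), ENNReal.ofReal_ofNat]
    _ ≤ 4 * ∑ k ∈ Finset.range N, μH[1] (boundaryCurve Ω c '' Ico (t k) (t (k + 1))) := by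
      gcongr with k
      rw [hv', hv']
      exact h.ofReal_dist_le_hausdorffMeasure_arc hc (htm (Nat.le_succ k))
    _ = 4 * μH[1] (frontier Ω) := by
      rw [hsum N le_rfl, htN, h.image_boundaryCurve hc]

/-- The vertices become dense in the boundary. The conclusion is needed for all large N, since the
polygons for successive N are not nested. -/
lemma exists_forall_vertex_mem (h : IsConvexDomain Ω) (hc : c ∈ Ω) {U : Set Plane} (hU : IsOpen U)
    (hUf : (frontier Ω ∩ U).Nonempty) :
    ∃ N₀ : ℕ, ∀ N ≥ N₀, ∃ i ≤ N, boundaryCurve Ω c (2 * Real.pi * i / N) ∈ U := by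
  obtain ⟨y, hyf, hyU⟩ := hUf
  rw [← h.image_boundaryCurve hc] at hyf
  obtain ⟨t, ht, rfl⟩ := hyf
  have hpi := Real.pi_pos
  obtain ⟨δ, hδ, hball⟩ := Metric.isOpen_iff.1
    (hU.preimage (h.continuous_boundaryCurve hc)) t hyU
  obtain ⟨N₀, hN₀⟩ := exists_nat_gt (2 * Real.pi / δ)
  refine ⟨N₀, fun N hN => ?_⟩
  have hNr : 2 * Real.pi / δ < N := hN₀.trans_le (Nat.cast_le.2 hN)
  have hNpos : (0 : ℝ) < N := (by positivity : 0 < 2 * Real.pi / δ).trans hNr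
  have ht0 : 0 ≤ t * N / (2 * Real.pi) := by have := ht.1; positivity
  refine ⟨⌊t * N / (2 * Real.pi)⌋₊, ?_, hball ?_⟩
  · refine Nat.floor_le_of_le ?_
    rw [div_le_iff₀ (by positivity)]
    nlinarith [ht.2]
  · have h1 := Nat.floor_le ht0
    have h2 := Nat.lt_floor_add_one (t * N / (2 * Real.pi))
    rw [le_div_iff₀ (by positivity)] at h1
    rw [div_lt_iff₀ (by positivity)] at h2
    rw [div_lt_iff₀ hδ] at hNr
    rw [Metric.mem_ball, Real.dist_eq, abs_lt]
    set i : ℝ := (⌊t * N / (2 * Real.pi)⌋₊ : ℝ)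
    constructor
    · rw [lt_sub_iff_add_lt, lt_div_iff₀ hNpos]
      nlinarith
    · rw [sub_lt_iff_lt_add, div_lt_iff₀ hNpos]
      nlinarith

/-- Lines meeting `Ω` have boundary points strictly on either side. -/
lemma exists_frontier_lt_of_mem_linesMeeting (h : IsConvexDomain Ω) {q : ℝ × ℝ}
    (hq : q ∈ linesMeeting Ω) :
    (∃ y ∈ frontier Ω, normalCoord q.1 y < q.2) ∧ ∃ y ∈ frontier Ω, q.2 < normalCoord q.1 y := by
  obtain ⟨x, hx, hxq⟩ := hq
  have hu : normalCoord q.1 (unitVec q.1) = 1 := by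
    rw [normalCoord, unitVec_zero_apply, unitVec_one_apply]
    linarith [Real.sin_sq_add_cos_sq q.1]
  have hne := unitVec_ne_zero q.1
  have h1 := inv_pos.2 (h.gaugeAt_pos hx hne)
  have h2 := inv_pos.2 (h.gaugeAt_pos hx (neg_ne_zero.2 hne))
  refine ⟨⟨_, h.radialPoint_mem_frontier hx (neg_ne_zero.2 hne), ?_⟩,
    ⟨_, h.radialPoint_mem_frontier hx hne, ?_⟩⟩
  · rw [radialPoint, smul_neg, ← sub_eq_add_neg, normalCoord_sub, normalCoord_smul, hu, hxq]
    linarith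
  · rw [radialPoint, normalCoord_add, normalCoord_smul, hu, hxq]
    linarith

/-- Every line through the domain eventually separates vertices of the inscribed polygons, whose
perimeters do not exceed the boundary length. -/
lemma kinematicMeasure_linesMeeting_le (h : IsConvexDomain Ω) (hne : Ω.Nonempty) :
    kinematicMeasure (linesMeeting Ω) ≤ 2 * μH[1] (frontier Ω) := by
  obtain ⟨c, hc⟩ := hne
  let S : ℕ → Set (ℝ × ℝ) := fun N => {q | ∃ i ≤ N, ∃ j ≤ N,
    normalCoord q.1 (boundaryCurve Ω c (2 * Real.pi * i / N)) < q.2 ∧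
      q.2 < normalCoord q.1 (boundaryCurve Ω c (2 * Real.pi * j / N))}
  have hS : ∀ N > 0, kinematicMeasure (S N) ≤ 2 * μH[1] (frontier Ω) := fun N hN => by
    have := h.two_mul_kinematicMeasure_separating_le hc hN
      (v := fun i => boundaryCurve Ω c (2 * Real.pi * i / N)) fun i => rfl
    rw [show (4 : ℝ≥0∞) = 2 * 2 by norm_num, mul_assoc] at this
    exact (ENNReal.mul_le_mul_iff_right two_ne_zero ENNReal.ofNat_ne_top).1 this
  -- The sets `S N` need not increase, so continuity from below is applied to their tail
  -- intersections. Starting at N + 1 excludes the degenerate polygon with no sides.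
  let E : ℕ → Set (ℝ × ℝ) := fun N => ⋂ M ≥ N + 1, S M
  have hEmono : Monotone E := fun N M hNM =>
    biInter_subset_biInter_left fun k (hk : M + 1 ≤ k) => (by omega : N + 1 ≤ k)
  have hsub : linesMeeting Ω ⊆ ⋃ N, E N := by
    intro q hq
    obtain ⟨⟨y, hy, hyq⟩, ⟨z, hz, hzq⟩⟩ := h.exists_frontier_lt_of_mem_linesMeeting hq
    have hcont := (lipschitzWith_normalCoord q.1).continuous
    obtain ⟨N₁, hN₁⟩ := h.exists_forall_vertex_mem hc (isOpen_Iio.preimage hcont) ⟨y, hy, hyq⟩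
    obtain ⟨N₂, hN₂⟩ := h.exists_forall_vertex_mem hc (isOpen_Ioi.preimage hcont) ⟨z, hz, hzq⟩
    refine mem_iUnion.2 ⟨max N₁ N₂, mem_iInter₂.2 fun M hM => ?_⟩
    obtain ⟨i, hi, hi'⟩ := hN₁ M (by have := le_max_left N₁ N₂; omega)
    obtain ⟨j, hj, hj'⟩ := hN₂ M (by have := le_max_right N₁ N₂; omega)
    exact ⟨i, hi, j, hj, hi', hj'⟩
  refine (measure_mono hsub).trans ?_
  rw [hEmono.measure_iUnion]
  refine iSup_le fun N => (measure_mono ?_).trans (hS (N + 1) (Nat.succ_pos N))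
  exact biInter_subset_of_mem (show N + 1 ≥ N + 1 from le_rfl)

/-! ### Arc length on the boundary -/

/-- The boundary has an arc-length parametrization. -/
lemma exists_arclength_param (h : IsConvexDomain Ω) (hne : Ω.Nonempty) :
    ∃ σ : ℝ → Plane, BijOn σ (Ico 0 (boundaryLength Ω)) (frontier Ω) ∧
      ∀ a b, 0 ≤ a → a ≤ b → b ≤ boundaryLength Ω →
        MeasurableSet (σ '' Ico a b) ∧ μH[1] (σ '' Ico a b) = ENNReal.ofReal (b - a) := by
  have hfin := h.hausdorffMeasure_frontier_ne_top hne
  obtain ⟨c, hc⟩ := hne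
  have hpi := Real.pi_pos
  set T := 2 * Real.pi with hT
  have hT0 : 0 < T := by positivity
  set γ := boundaryCurve Ω c with hγ
  set P := boundaryLength Ω with hP
  have harcfin : ∀ a b, 0 ≤ a → b ≤ T → μH[1] (γ '' Ico a b) ≠ ⊤ := fun a b ha hb =>
    ne_top_of_le_ne_top hfin (measure_mono (by
      rw [← h.image_boundaryCurve hc]; exact image_mono (Ico_subset_Ico ha hb)))
  -- The length of the arc from angle 0 to t. It is continuous and strictly increasing, and σ will
  -- be the boundary curve composed with its inverse.
  let F : ℝ → ℝ := fun t => (μH[1] (γ '' Ico 0 t)).toReal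
  have hF0 : F 0 = 0 := by simp [F]
  have hFT : F T = P := by simp only [F, hγ, hT, h.image_boundaryCurve hc]; rfl
  have hFsub : ∀ s t, 0 ≤ s → s ≤ t → t ≤ T → F t = F s + (μH[1] (γ '' Ico s t)).toReal := by
    intro s t hs hst ht
    simp only [F]
    rw [h.hausdorffMeasure_arc_add hc le_rfl hs hst ht,
      ENNReal.toReal_add (harcfin _ _ le_rfl (hst.trans ht)) (harcfin _ _ hs ht)]
  have hFmono : ∀ s t, 0 ≤ s → s ≤ t → t ≤ T → F s ≤ F t := fun s t hs hst ht => by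
    rw [hFsub s t hs hst ht]; linarith [(ENNReal.toReal_nonneg : 0 ≤ (μH[1] (γ '' Ico s t)).toReal)]
  have hFlt : ∀ s t, 0 ≤ s → s < t → t ≤ T → F s < F t := by
    intro s t hs hst ht
    -- The curve closes up at t = 2π, where the chord from s could degenerate; the midpoint stays in
    -- the half-open interval of injectivity.
    have hm1 : s < (s + t) / 2 := by linarith
    have hm2 : (s + t) / 2 < t := by linarith
    refine lt_of_lt_of_le ?_ (hFmono ((s + t) / 2) t (by linarith) hm2.le ht)
    rw [hFsub s _ hs hm1.le (by linarith)]
    have hd : 0 < dist (γ s) (γ ((s + t) / 2)) := dist_pos.2 fun he =>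
      hm1.ne (h.injOn_boundaryCurve hc ⟨hs, by linarith⟩ ⟨by linarith, by linarith⟩ he)
    have h1 := h.ofReal_dist_le_hausdorffMeasure_arc hc hm1.le
    have h2 := (ENNReal.ofReal_pos.2 hd).trans_le h1
    have h3 := ENNReal.toReal_pos h2.ne' (harcfin s ((s + t) / 2) hs (by linarith))
    linarith
  have hFcont : ContinuousOn F (Icc 0 T) := by
    obtain ⟨K, hK⟩ := h.exists_hausdorffMeasure_arc_le hc
    have hle : ∀ s t, 0 ≤ s → s ≤ t → t ≤ T → |F s - F t| ≤ K * |s - t| := by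
      intro s t hs hst ht
      have h1 := ENNReal.toReal_mono
        (ENNReal.mul_ne_top ENNReal.coe_ne_top ENNReal.ofReal_ne_top) (hK s t)
      rw [ENNReal.toReal_mul, ENNReal.coe_toReal, ENNReal.toReal_ofReal (by linarith)] at h1
      rw [abs_sub_comm, abs_sub_comm s, abs_of_nonneg (by linarith [hFmono s t hs hst ht]),
        abs_of_nonneg (by linarith), hFsub s t hs hst ht]
      linarith
    have : LipschitzOnWith K F (Icc 0 T) := LipschitzOnWith.of_dist_le_mul fun s hs t ht => by
      rw [Real.dist_eq, Real.dist_eq]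
      rcases le_total s t with hst | hst
      · exact hle s t hs.1 hst ht.2
      · rw [abs_sub_comm, abs_sub_comm s]
        exact hle t s ht.1 hst hs.2
    exact this.continuousOn
  have hsurj : ∀ a : Icc (0 : ℝ) P, ∃ t ∈ Icc 0 T, F t = a := fun a => by
    have := intermediate_value_Icc hT0.le hFcont
    rw [hF0, hFT] at this
    exact this a.2
  have hFlt' : ∀ s t, s ∈ Icc 0 T → t ∈ Icc 0 T → (F s < F t ↔ s < t) := by
    intro s t hs ht
    refine ⟨fun hlt => ?_, fun hlt => hFlt s t hs.1 hlt ht.2⟩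
    by_contra! hle
    exact absurd (hFmono t s ht.1 hle hs.2) hlt.not_ge
  choose τ hτ hFτ using hsurj
  let σ : ℝ → Plane := fun a => if ha : a ∈ Icc 0 P then γ (τ ⟨a, ha⟩) else 0
  have himg : ∀ a b (ha : a ∈ Icc 0 P) (hb : b ∈ Icc 0 P),
      σ '' Ico a b = γ '' Ico (τ ⟨a, ha⟩) (τ ⟨b, hb⟩) := by
    intro a b ha hb
    apply Subset.antisymm
    · rintro _ ⟨u, hu, rfl⟩
      have huP : u ∈ Icc 0 P := ⟨ha.1.trans hu.1, hu.2.le.trans hb.2⟩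
      refine ⟨τ ⟨u, huP⟩, ⟨?_, ?_⟩, by simp only [σ, dif_pos huP]⟩
      · rw [← not_lt, ← hFlt' _ _ (hτ _) (hτ _), hFτ, hFτ, not_lt]; exact hu.1
      · rw [← hFlt' _ _ (hτ _) (hτ _), hFτ, hFτ]; exact hu.2
    · rintro _ ⟨t, ht, rfl⟩
      have htT : t ∈ Icc 0 T := ⟨(hτ _).1.trans ht.1, ht.2.le.trans (hτ _).2⟩
      have h1 : a ≤ F t := by
        have := hFmono _ _ (hτ ⟨a, ha⟩).1 ht.1 htT.2
        rwa [hFτ] at this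
      have h2 : F t < b := by
        have := hFlt _ _ htT.1 ht.2 (hτ _).2
        rwa [hFτ] at this
      have hFP : F t ∈ Icc 0 P := ⟨ha.1.trans h1, h2.le.trans hb.2⟩
      refine ⟨F t, ⟨h1, h2⟩, ?_⟩
      simp only [σ, dif_pos hFP]
      congr 1
      have hA := hFτ ⟨F t, hFP⟩
      rcases lt_trichotomy (τ ⟨F t, hFP⟩) t with hlt | heq | hlt
      · exact absurd hA ((hFlt' _ _ (hτ _) htT).2 hlt).ne
      · exact heq
      · exact absurd hA ((hFlt' _ _ htT (hτ _)).2 hlt).ne'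
  have hP0 : 0 ≤ P := ENNReal.toReal_nonneg
  have hinjF : ∀ s t, s ∈ Icc 0 T → t ∈ Icc 0 T → F s = F t → s = t := by
    intro s t hs ht hst
    rcases lt_trichotomy s t with hlt | heq | hlt
    · exact absurd hst ((hFlt' _ _ hs ht).2 hlt).ne
    · exact heq
    · exact absurd hst ((hFlt' _ _ ht hs).2 hlt).ne'
  refine ⟨σ, ⟨?_, ?_, ?_⟩, ?_⟩
  · intro a ha
    simp only [σ, dif_pos (Ico_subset_Icc_self ha)]
    exact h.boundaryCurve_mem_frontier hc _
  · intro a ha b hb hab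
    simp only [σ, dif_pos (Ico_subset_Icc_self ha), dif_pos (Ico_subset_Icc_self hb)] at hab
    have hlt : ∀ a (ha : a ∈ Ico 0 P), τ ⟨a, Ico_subset_Icc_self ha⟩ ∈ Ico 0 T := fun a ha => by
      refine ⟨(hτ _).1, ?_⟩
      rw [← hFlt' _ _ (hτ _) ⟨hT0.le, le_rfl⟩, hFτ, hFT]
      exact ha.2
    have := h.injOn_boundaryCurve hc (hlt a ha) (hlt b hb) hab
    have h2 := congrArg F this
    rwa [hFτ, hFτ] at h2
  · have h0 : τ ⟨0, ⟨le_rfl, hP0⟩⟩ = 0 :=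
      hinjF _ _ (hτ _) ⟨le_rfl, hT0.le⟩ (by rw [hFτ, hF0])
    have h1 : τ ⟨P, ⟨hP0, le_rfl⟩⟩ = T :=
      hinjF _ _ (hτ _) ⟨hT0.le, le_rfl⟩ (by rw [hFτ, hFT])
    rw [SurjOn, himg 0 P ⟨le_rfl, hP0⟩ ⟨hP0, le_rfl⟩, h0, h1, hγ, h.image_boundaryCurve hc]
  · intro a b ha hab hb
    have haP : a ∈ Icc 0 P := ⟨ha, hab.trans hb⟩
    have hbP : b ∈ Icc 0 P := ⟨ha.trans hab, hb⟩
    rw [himg a b haP hbP]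
    refine ⟨h.measurableSet_arc hc (hτ _).1 (hτ _).2, ?_⟩
    have hle : τ ⟨a, haP⟩ ≤ τ ⟨b, hbP⟩ := by
      rw [← not_lt, ← hFlt' _ _ (hτ _) (hτ _), hFτ, hFτ, not_lt]; exact hab
    have h1 := hFsub _ _ (hτ ⟨a, haP⟩).1 hle (hτ ⟨b, hbP⟩).2
    rw [hFτ, hFτ] at h1
    rw [← ENNReal.ofReal_toReal (harcfin _ _ (hτ ⟨a, haP⟩).1 (hτ ⟨b, hbP⟩).2)]
    congr 1
    simp only at h1
    linarith

end IsConvexDomain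

/-! ### Intersection numbers of segments and boundary copies -/

lemma intersectionNumber_eq_zero {θ : Plane → ℕ} {q : ℝ × ℝ} (h : ∀ x ∈ lineOf q, θ x = 0) :
    intersectionNumber θ q = 0 :=
  ENNReal.tsum_eq_zero.2 fun x => by simp [h x x.2]

lemma intersectionNumber_eq_single {θ : Plane → ℕ} {q : ℝ × ℝ} {y : Plane} (hy : y ∈ lineOf q)
    (h : ∀ x ∈ lineOf q, θ x ≠ 0 → x = y) : intersectionNumber θ q = θ y := by
  rw [intersectionNumber, tsum_eq_single (⟨y, hy⟩ : lineOf q)]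
  intro x hx
  by_contra h0
  exact hx (Subtype.ext (h x x.2 fun h' => h0 (by simp [h'])))

lemma intersectionNumber_eq_pair {θ : Plane → ℕ} {q : ℝ × ℝ} {y z : Plane} (hyz : y ≠ z)
    (hy : y ∈ lineOf q) (hz : z ∈ lineOf q)
    (h : ∀ x ∈ lineOf q, θ x ≠ 0 → x = y ∨ x = z) :
    intersectionNumber θ q = θ y + θ z := by
  classical
  have hne : (⟨y, hy⟩ : lineOf q) ≠ ⟨z, hz⟩ := fun h' => hyz (congrArg Subtype.val h')
  rw [intersectionNumber, tsum_eq_sum (s := {⟨y, hy⟩, ⟨z, hz⟩}), Finset.sum_pair hne]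
  intro x hx
  simp only [Finset.mem_insert, Finset.mem_singleton, not_or] at hx
  by_contra h0
  rcases h x x.2 fun h' => h0 (by simp [h']) with h1 | h1
  · exact hx.1 (Subtype.ext h1)
  · exact hx.2 (Subtype.ext h1)

/-- A finite sum has only finitely many terms that are at least 1, and all others vanish. This is
the integrality behind the fractional-part term in the lower bound. -/
lemma intersectionNumber_eq_top_or_natCast (θ : Plane → ℕ) (q : ℝ × ℝ) :
    intersectionNumber θ q = ⊤ ∨ ∃ m : ℕ, intersectionNumber θ q = m := by
  by_cases h : intersectionNumber θ q = ⊤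
  · exact Or.inl h
  right
  have hf := ENNReal.finite_const_le_of_tsum_ne_top h one_ne_zero
  refine ⟨∑ x ∈ hf.toFinset, θ x, ?_⟩
  rw [intersectionNumber, tsum_eq_sum (s := hf.toFinset), Nat.cast_sum]
  intro x hx
  simp only [Finite.mem_toFinset, mem_ofPred_eq, not_le, Nat.cast_lt_one] at hx
  simp [hx]

lemma IsOneRectifiable.union {S T : Set Plane} (hS : IsOneRectifiable S)
    (hT : IsOneRectifiable T) : IsOneRectifiable (S ∪ T) := by
  obtain ⟨hSm, f, hf, hf0⟩ := hS
  obtain ⟨hTm, g, hg, hg0⟩ := hT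
  refine ⟨hSm.union hTm, fun k => if Even k then f (k / 2) else g (k / 2), fun k => ?_, ?_⟩
  · by_cases hk : Even k
    · simpa only [if_pos hk] using hf _
    · simpa only [if_neg hk] using hg _
  · refine measure_mono_null ?_ (measure_union_null hf0 hg0)
    rintro x ⟨hx | hx, hx'⟩
    · refine Or.inl ⟨hx, fun h => hx' ?_⟩
      obtain ⟨i, hi⟩ := mem_iUnion.1 h
      refine mem_iUnion.2 ⟨2 * i, ?_⟩
      simpa using hi
    · refine Or.inr ⟨hx, fun h => hx' ?_⟩
      obtain ⟨i, hi⟩ := mem_iUnion.1 h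
      refine mem_iUnion.2 ⟨2 * i + 1, ?_⟩
      have h1 : (2 * i + 1) / 2 = i := by omega
      have h2 : ¬ Even (2 * i + 1) := by simp
      simpa only [h1, if_neg h2] using hi

lemma isOneRectifiable_segment (a b : Plane) : IsOneRectifiable (segment ℝ a b) := by
  refine ⟨(isCompact_segment a b).measurableSet.nullMeasurableSet,
    fun _ => AffineMap.lineMap a b, fun _ => ⟨_, lipschitzWith_lineMap a b⟩, ?_⟩
  rw [sdiff_eq_empty.2, measure_empty]
  rw [segment_eq_image_lineMap]
  rintro _ ⟨t, -, rfl⟩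
  exact mem_iUnion.2 ⟨0, t, rfl⟩

lemma ae_intersectionNumber_segment (a b : Plane) :
    ∀ᵐ q ∂kinematicMeasure, intersectionNumber (multiplicityOne (segment ℝ a b)) q =
      (linesMeeting (segment ℝ a b)).indicator 1 q := by
  -- A line with two points on the segment must pass through `a`, and the lines through one point
  -- are null.
  filter_upwards [ae_notMem_linesMeeting (hausdorffMeasure_one_singleton a)] with q hq
  by_cases h : q ∈ linesMeeting (segment ℝ a b)
  · rw [indicator_of_mem h]
    obtain ⟨y, hy, hyq⟩ := h
    have := intersectionNumber_eq_single (θ := multiplicityOne (segment ℝ a b)) (q := q) (y := y)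
      hyq ?_
    · rw [this]; simp [multiplicityOne, hy]
    · intro x hxq hx
      have hx' : x ∈ segment ℝ a b := by
        by_contra h'; exact hx (by simp [multiplicityOne, h'])
      rw [segment_eq_image'] at hx' hy
      obtain ⟨s, -, rfl⟩ := hx'
      obtain ⟨t, -, rfl⟩ := hy
      rw [mem_lineOf] at hxq
      simp only [normalCoord_add, normalCoord_smul] at hxq hyq
      by_cases hst : s = t
      · rw [hst]
      · exfalso
        have h0 : (s - t) * normalCoord q.1 (b - a) = 0 := by linarith
        have h1 := (mul_eq_zero.1 h0).resolve_left (sub_ne_zero.2 hst)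
        rw [h1] at hyq
        exact hq ⟨a, rfl, by linarith⟩
  · rw [indicator_of_notMem h]
    refine intersectionNumber_eq_zero fun x hx => ?_
    have : x ∉ segment ℝ a b := fun h' => h ⟨x, h', hx⟩
    simp [multiplicityOne, this]

/-- The union of `n` copies of the boundary of `Ω` with the set `B`, with multiplicity. -/
def copiesWith (Ω : Set Plane) (n : ℕ) (B : Set Plane) : Plane → ℕ :=
  fun x => n * multiplicityOne (frontier Ω) x + multiplicityOne B x

lemma copiesWithSegment_eq (Ω : Set Plane) (n : ℕ) (a b : Plane) :
    copiesWithSegment Ω n a b = copiesWith Ω n (segment ℝ a b) := rfl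

lemma intersectionNumber_copiesWith (Ω : Set Plane) (n : ℕ) (B : Set Plane) (q : ℝ × ℝ) :
    intersectionNumber (copiesWith Ω n B) q =
      n * intersectionNumber (multiplicityOne (frontier Ω)) q +
        intersectionNumber (multiplicityOne B) q := by
  simp only [intersectionNumber, copiesWith, Nat.cast_add, Nat.cast_mul]
  rw [ENNReal.tsum_add, ENNReal.tsum_mul_left]

lemma measurable_multiplicityOne {A : Set Plane} (hA : MeasurableSet A) :
    Measurable (multiplicityOne A) := measurable_one.indicator hA

lemma lintegral_multiplicityOne {A : Set Plane} (hA : MeasurableSet A) :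
    ∫⁻ x, (multiplicityOne A x : ℝ≥0∞) ∂(μH[1] : Measure Plane) = μH[1] A := by
  rw [← lintegral_indicator_one hA]
  refine lintegral_congr fun x => ?_
  by_cases h : x ∈ A <;> simp [multiplicityOne, h]

namespace IsConvexDomain

variable {Ω : Set Plane} {c : Plane}

lemma isOneRectifiable_frontier (h : IsConvexDomain Ω) (hne : Ω.Nonempty) :
    IsOneRectifiable (frontier Ω) := by
  obtain ⟨c, hc⟩ := hne
  refine ⟨isClosed_frontier.measurableSet.nullMeasurableSet, fun _ => boundaryCurve Ω c,
    fun _ => h.exists_lipschitzWith_boundaryCurve hc, ?_⟩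
  rw [sdiff_eq_empty.2, measure_empty]
  rw [← h.image_boundaryCurve hc]
  rintro _ ⟨t, -, rfl⟩
  exact mem_iUnion.2 ⟨0, t, rfl⟩

lemma ofReal_boundaryLength (h : IsConvexDomain Ω) (hne : Ω.Nonempty) :
    ENNReal.ofReal (boundaryLength Ω) = μH[1] (frontier Ω) :=
  ENNReal.ofReal_toReal (h.hausdorffMeasure_frontier_ne_top hne)

lemma boundaryLength_pos (h : IsConvexDomain Ω) (hne : Ω.Nonempty) : 0 < boundaryLength Ω := by
  have hfin := h.hausdorffMeasure_frontier_ne_top hne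
  obtain ⟨c, hc⟩ := hne
  have hpi := Real.pi_pos
  refine ENNReal.toReal_pos (ne_of_gt ?_) hfin
  have hd : 0 < dist (boundaryCurve Ω c 0) (boundaryCurve Ω c Real.pi) := dist_pos.2 fun he =>
    hpi.ne (h.injOn_boundaryCurve hc ⟨le_rfl, by linarith⟩ ⟨hpi.le, by linarith⟩ he)
  refine (ENNReal.ofReal_pos.2 hd).trans_le
    ((h.ofReal_dist_le_hausdorffMeasure_arc hc hpi.le).trans (measure_mono ?_))
  rintro _ ⟨t, -, rfl⟩
  exact h.boundaryCurve_mem_frontier hc t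

lemma measurableSet_linesMeeting (h : IsConvexDomain Ω) : MeasurableSet (linesMeeting Ω) :=
  (isOpen_linesMeeting h.isOpen).measurableSet

lemma ae_intersectionNumber_eq_zero (h : IsConvexDomain Ω) {θ : Plane → ℕ}
    (hθ : {x | θ x ≠ 0} ⊆ closure Ω) :
    ∀ᵐ q ∂kinematicMeasure, q ∉ linesMeeting Ω → intersectionNumber θ q = 0 := by
  filter_upwards [h.ae_mem_linesMeeting] with q hq hqΩ
  refine intersectionNumber_eq_zero fun x hx => ?_
  by_contra h0
  exact hqΩ (hq ⟨x, hθ h0, hx⟩)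

lemma support_multiplicityOne_subset (A : Set Plane) (hA : A ⊆ closure Ω) :
    {x | multiplicityOne A x ≠ 0} ⊆ closure Ω := fun x hx => hA (by
      by_contra h'; exact hx (by simp [multiplicityOne, h']))

lemma ae_intersectionNumber_frontier (h : IsConvexDomain Ω) :
    ∀ᵐ q ∂kinematicMeasure, intersectionNumber (multiplicityOne (frontier Ω)) q =
      (linesMeeting Ω).indicator (fun _ => 2) q := by
  filter_upwards [h.ae_intersectionNumber_eq_zero
    (support_multiplicityOne_subset _ frontier_subset_closure)] with q hq0
  by_cases hq : q ∈ linesMeeting Ω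
  · obtain ⟨y, z, hyz, heq⟩ := h.exists_lineOf_inter_frontier_eq hq
    have hy : y ∈ lineOf q ∩ frontier Ω := by rw [heq]; simp
    have hz : z ∈ lineOf q ∩ frontier Ω := by rw [heq]; simp
    rw [indicator_of_mem hq, intersectionNumber_eq_pair hyz hy.1 hz.1]
    · simp [multiplicityOne, hy.2, hz.2]; norm_num
    · intro x hx hx0
      have : x ∈ lineOf q ∩ frontier Ω := ⟨hx, by
        by_contra h'; exact hx0 (by simp [multiplicityOne, h'])⟩
      rwa [heq] at this
  · rw [indicator_of_notMem hq, hq0 hq]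

/-- The Cauchy–Crofton formula for the boundary of a convex domain. -/
lemma kinematicMeasure_linesMeeting_eq (h : IsConvexDomain Ω) (hne : Ω.Nonempty) :
    kinematicMeasure (linesMeeting Ω) = 2 * μH[1] (frontier Ω) := by
  apply le_antisymm (h.kinematicMeasure_linesMeeting_le hne)
  have h1 := four_mul_hausdorffMeasure_le_lintegral (h.isOneRectifiable_frontier hne)
    (h.hausdorffMeasure_frontier_ne_top hne) (θ := multiplicityOne (frontier Ω))
    (fun x hx => by simp [multiplicityOne, hx])
  rw [lintegral_congr_ae h.ae_intersectionNumber_frontier,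
    lintegral_indicator_const h.measurableSet_linesMeeting,
    show (4 : ℝ≥0∞) = 2 * 2 by norm_num, mul_assoc] at h1
  exact (ENNReal.mul_le_mul_iff_right two_ne_zero ENNReal.ofNat_ne_top).1 h1

lemma kinematicMeasure_linesMeeting_ne_top (h : IsConvexDomain Ω) (hne : Ω.Nonempty) :
    kinematicMeasure (linesMeeting Ω) ≠ ⊤ := by
  rw [h.kinematicMeasure_linesMeeting_eq hne]
  exact ENNReal.mul_ne_top ENNReal.ofNat_ne_top (h.hausdorffMeasure_frontier_ne_top hne)

/-! ### Energy bounds and competitors -/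

/-- The linear lower bound for the energy obtained from `(m - k) (m - k - 1) ≥ 0`. -/
lemma ofReal_le_croftonEnergy (h : IsConvexDomain Ω) (hne : Ω.Nonempty) {L : ℝ}
    {θ : Plane → ℕ} (hθ : IsCompetitor Ω L θ) (k : ℕ) :
    ENNReal.ofReal ((2 * k + 1) * L - k * (k + 1) * boundaryLength Ω / 2) ≤ croftonEnergy θ := by
  obtain ⟨hrect, hsupp, hlen⟩ := hθ
  have hP := h.boundaryLength_pos hne
  have hcrof := four_mul_multisetLength_le_lintegral hrect
    (by rw [hlen]; exact ENNReal.ofReal_ne_top)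
  have hpt : ∀ᵐ q ∂kinematicMeasure, (2 * k + 1 : ℝ≥0∞) * intersectionNumber θ q ≤
      intersectionNumber θ q ^ 2 +
        (linesMeeting Ω).indicator (fun _ => (k * (k + 1) : ℝ≥0∞)) q := by
    filter_upwards [h.ae_intersectionNumber_eq_zero hsupp] with q hq0
    by_cases hq : q ∈ linesMeeting Ω
    · rw [indicator_of_mem hq]
      rcases intersectionNumber_eq_top_or_natCast θ q with ht | ⟨m, hm⟩
      · rw [ht]; simp
      · rw [hm]
        have : (2 * k + 1) * m ≤ m ^ 2 + k * (k + 1) := by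
          zify
          rcases le_or_gt m k with hmk | hmk
          · have h1 : (m : ℤ) ≤ k := by exact_mod_cast hmk
            nlinarith [mul_nonneg (sub_nonneg.2 h1) (by linarith : (0 : ℤ) ≤ k + 1 - m)]
          · have h1 : (k : ℤ) + 1 ≤ m := by exact_mod_cast hmk
            nlinarith [mul_nonneg (sub_nonneg.2 h1) (by linarith : (0 : ℤ) ≤ m - k)]
        exact_mod_cast this
    · rw [hq0 hq]; simp
  -- Only the half 4·length ≤ ∫ n of Crofton's formula enters, and constants are moved into the
  -- integral in the direction valid without measurability of n.
  have hint : (2 * k + 1 : ℝ≥0∞) * (4 * ENNReal.ofReal L) ≤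
      (∫⁻ q, intersectionNumber θ q ^ 2 ∂kinematicMeasure) +
        k * (k + 1) * (2 * ENNReal.ofReal (boundaryLength Ω)) := by
    calc (2 * k + 1 : ℝ≥0∞) * (4 * ENNReal.ofReal L)
        ≤ (2 * k + 1 : ℝ≥0∞) * ∫⁻ q, intersectionNumber θ q ∂kinematicMeasure := by
          rw [← hlen]; gcongr
      _ ≤ ∫⁻ q, (2 * k + 1 : ℝ≥0∞) * intersectionNumber θ q ∂kinematicMeasure :=
          lintegral_const_mul_le _ _
      _ ≤ ∫⁻ q, (intersectionNumber θ q ^ 2 +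
            (linesMeeting Ω).indicator (fun _ => (k * (k + 1) : ℝ≥0∞)) q) ∂kinematicMeasure :=
          lintegral_mono_ae hpt
      _ = _ := by
          rw [lintegral_add_right _ (measurable_const.indicator h.measurableSet_linesMeeting),
            lintegral_indicator_const h.measurableSet_linesMeeting,
            h.kinematicMeasure_linesMeeting_eq hne, h.ofReal_boundaryLength hne]
  rw [croftonEnergy, ENNReal.le_div_iff_mul_le (by simp) (by simp),
    show (4 : ℝ≥0∞) = ENNReal.ofReal 4 by simp, ← ENNReal.ofReal_mul' (by norm_num)]
  have hrw : ((2 * k + 1) * L - k * (k + 1) * boundaryLength Ω / 2) * 4 =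
      (2 * k + 1) * (4 * L) - k * (k + 1) * (2 * boundaryLength Ω) := by ring
  rw [hrw, ENNReal.ofReal_sub _ (by positivity), tsub_le_iff_right]
  convert hint using 1
  · rw [ENNReal.ofReal_mul (by positivity), ENNReal.ofReal_mul (by positivity),
      ENNReal.ofReal_add (by positivity) (by positivity), ENNReal.ofReal_mul (by positivity)]
    simp
  · rw [ENNReal.ofReal_mul (by positivity), ENNReal.ofReal_mul (by positivity),
      ENNReal.ofReal_add (by positivity) (by positivity), ENNReal.ofReal_mul (by positivity)]
    simp

lemma isCompetitor_copiesWith (h : IsConvexDomain Ω) (hne : Ω.Nonempty) {n : ℕ} {B : Set Plane}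
    (hB : MeasurableSet B) (hBΩ : B ⊆ closure Ω) (hBr : IsOneRectifiable B) {r L : ℝ} (hr : 0 ≤ r)
    (hBL : μH[1] B = ENNReal.ofReal r) (hL : L = n * boundaryLength Ω + r) :
    IsCompetitor Ω L (copiesWith Ω n B) := by
  have hfm : MeasurableSet (frontier Ω) := isClosed_frontier.measurableSet
  have hm : Measurable (copiesWith Ω n B) :=
    (measurable_const.mul (measurable_multiplicityOne hfm)).add (measurable_multiplicityOne hB)
  have hsub : {x | copiesWith Ω n B x ≠ 0} ⊆ frontier Ω ∪ B := by
    intro x hx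
    by_contra h'
    rw [mem_union, not_or] at h'
    exact hx (by simp [copiesWith, multiplicityOne, h'.1, h'.2])
  refine ⟨⟨hm.nullMeasurable, ?_⟩, hsub.trans (union_subset frontier_subset_closure hBΩ), ?_⟩
  · exact ((h.isOneRectifiable_frontier hne).union hBr).mono hsub
      (hm (measurableSet_singleton 0).compl).nullMeasurableSet
  · have hP := h.boundaryLength_pos hne
    have hcast : ∀ {A : Set Plane}, MeasurableSet A →
        Measurable fun x => (multiplicityOne A x : ℝ≥0∞) := fun hA =>
      (measurable_from_top (f := fun m : ℕ => (m : ℝ≥0∞))).comp (measurable_multiplicityOne hA)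
    simp only [multisetLength, copiesWith, Nat.cast_add, Nat.cast_mul]
    rw [lintegral_add_right _ (hcast hB), lintegral_const_mul _ (hcast hfm),
      lintegral_multiplicityOne hfm, lintegral_multiplicityOne hB, hBL,
      ← h.ofReal_boundaryLength hne, hL, ENNReal.ofReal_add (by positivity) hr,
      ENNReal.ofReal_mul (by positivity), ENNReal.ofReal_natCast]

/-- Almost every line through the domain meets the boundary copies exactly 2n times, so the square
is (2n + m)² with m the count for `B`; the constant term is integrated over lines of total measure
2P. -/
lemma lintegral_sq_copiesWith (h : IsConvexDomain Ω) (hne : Ω.Nonempty) (n : ℕ) {B : Set Plane}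
    (hBΩ : B ⊆ closure Ω)
    (hBm : AEMeasurable (intersectionNumber (multiplicityOne B)) kinematicMeasure) :
    ∫⁻ q, intersectionNumber (copiesWith Ω n B) q ^ 2 ∂kinematicMeasure =
      8 * n ^ 2 * μH[1] (frontier Ω) +
        (4 * n * (∫⁻ q, intersectionNumber (multiplicityOne B) q ∂kinematicMeasure) +
          ∫⁻ q, intersectionNumber (multiplicityOne B) q ^ 2 ∂kinematicMeasure) := by
  have hpt : ∀ᵐ q ∂kinematicMeasure, intersectionNumber (copiesWith Ω n B) q ^ 2 =
      (linesMeeting Ω).indicator (fun _ => (4 * n ^ 2 : ℝ≥0∞)) q +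
        (4 * n * intersectionNumber (multiplicityOne B) q +
          intersectionNumber (multiplicityOne B) q ^ 2) := by
    filter_upwards [h.ae_intersectionNumber_frontier,
      h.ae_intersectionNumber_eq_zero (support_multiplicityOne_subset _ hBΩ)] with q hq1 hq2
    rw [intersectionNumber_copiesWith, hq1]
    by_cases hq : q ∈ linesMeeting Ω
    · rw [indicator_of_mem hq, indicator_of_mem hq]; ring
    · rw [indicator_of_notMem hq, indicator_of_notMem hq, hq2 hq]; simp
  rw [lintegral_congr_ae hpt,
    lintegral_add_left (measurable_const.indicator h.measurableSet_linesMeeting),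
    lintegral_indicator_const h.measurableSet_linesMeeting,
    lintegral_add_left' (hBm.const_mul _), lintegral_const_mul'' _ hBm,
    h.kinematicMeasure_linesMeeting_eq hne]
  ring

lemma energy_eq_ofReal (h : IsConvexDomain Ω) (hne : Ω.Nonempty) (n : ℕ) {r e : ℝ} (hr : 0 ≤ r)
    (he : 0 ≤ e) :
    (8 * n ^ 2 * μH[1] (frontier Ω) + (4 * n * ENNReal.ofReal (4 * r) +
      ENNReal.ofReal (4 * e))) / 4 =
      ENNReal.ofReal (2 * n ^ 2 * boundaryLength Ω + 4 * n * r + e) := by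
  have hP := h.boundaryLength_pos hne
  rw [← h.ofReal_boundaryLength hne, show (4 : ℝ≥0∞) = ENNReal.ofReal 4 by simp,
    show (8 : ℝ≥0∞) = ENNReal.ofReal 8 by simp,
    ← ENNReal.ofReal_natCast n, ← ENNReal.ofReal_pow (by positivity),
    ← ENNReal.ofReal_mul (by positivity), ← ENNReal.ofReal_mul (by positivity),
    ← ENNReal.ofReal_mul (by positivity), ← ENNReal.ofReal_mul (by positivity),
    ← ENNReal.ofReal_add (by positivity) (by positivity),
    ← ENNReal.ofReal_add (by positivity) (by positivity),
    ← ENNReal.ofReal_div_of_pos (by norm_num)]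
  congr 1; ring

/-- The energy of `n` copies of the boundary with a segment. -/
lemma croftonEnergy_copiesWith_segment (h : IsConvexDomain Ω) (hne : Ω.Nonempty) (n : ℕ)
    {a b : Plane} (ha : a ∈ closure Ω) (hb : b ∈ closure Ω) :
    croftonEnergy (copiesWith Ω n (segment ℝ a b)) =
      ENNReal.ofReal (2 * n ^ 2 * boundaryLength Ω + 4 * n * dist a b + dist a b) := by
  have hP := h.boundaryLength_pos hne
  have hms : MeasurableSet (linesMeeting (segment ℝ a b)) :=
    (isClosed_linesMeeting (isCompact_segment a b)).measurableSet
  have hae := ae_intersectionNumber_segment a b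
  have h1 : ∫⁻ q, intersectionNumber (multiplicityOne (segment ℝ a b)) q ∂kinematicMeasure =
      ENNReal.ofReal (4 * dist a b) := by
    rw [lintegral_congr_ae hae, lintegral_indicator_one hms, kinematicMeasure_linesMeeting_segment]
  have h2 : ∫⁻ q, intersectionNumber (multiplicityOne (segment ℝ a b)) q ^ 2 ∂kinematicMeasure =
      ENNReal.ofReal (4 * dist a b) := by
    rw [← h1]
    refine lintegral_congr_ae ?_
    filter_upwards [hae] with q hq
    rw [hq]
    by_cases h' : q ∈ linesMeeting (segment ℝ a b) <;> simp [h']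
  have hm : AEMeasurable (intersectionNumber (multiplicityOne (segment ℝ a b)))
      kinematicMeasure :=
    (measurable_one.indicator hms).aemeasurable.congr (hae.mono fun q hq => hq.symm)
  have hsub : segment ℝ a b ⊆ closure Ω := h.convex.closure.segment_subset ha hb
  rw [croftonEnergy, h.lintegral_sq_copiesWith hne n hsub hm, h1, h2]
  exact h.energy_eq_ofReal hne n dist_nonneg dist_nonneg

/-- Almost every line meeting the chord meets the domain: compare 4·dist with 2P. -/
lemma two_mul_dist_le_boundaryLength (h : IsConvexDomain Ω) (hne : Ω.Nonempty) {a b : Plane}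
    (ha : a ∈ closure Ω) (hb : b ∈ closure Ω) : 2 * dist a b ≤ boundaryLength Ω := by
  have hsub : segment ℝ a b ⊆ closure Ω := h.convex.closure.segment_subset ha hb
  have h1 : kinematicMeasure (linesMeeting (segment ℝ a b)) ≤ kinematicMeasure (linesMeeting Ω) :=
    measure_mono_ae (h.ae_mem_linesMeeting.mono fun q hq hqs => hq (linesMeeting_mono hsub hqs))
  have h2 : 2 * μH[1] (frontier Ω) = ENNReal.ofReal (2 * boundaryLength Ω) := by
    rw [← h.ofReal_boundaryLength hne, ENNReal.ofReal_mul (by norm_num), ENNReal.ofReal_ofNat]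
  rw [kinematicMeasure_linesMeeting_segment, h.kinematicMeasure_linesMeeting_eq hne, h2] at h1
  have hP := h.boundaryLength_pos hne
  have := (ENNReal.ofReal_le_ofReal_iff (by positivity)).1 h1
  linarith

/-- A longest chord of the compact closure is at least as long as the diameter; a shorter chord is
an initial piece of it. -/
lemma exists_dist_eq (h : IsConvexDomain Ω) (hne : Ω.Nonempty) {s : ℝ} (hs : 0 ≤ s)
    (hsd : s ≤ Metric.diam Ω) : ∃ a ∈ closure Ω, ∃ b ∈ closure Ω, dist a b = s := by
  have hcomp : IsCompact (closure Ω) := h.isBounded.isCompact_closure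
  obtain ⟨⟨a, b⟩, ⟨ha, hb⟩, hmax⟩ := (hcomp.prod hcomp).exists_isMaxOn
    (hne.closure.prod hne.closure) (f := fun z : Plane × Plane => dist z.1 z.2)
    continuous_dist.continuousOn
  have hle : Metric.diam Ω ≤ dist a b := Metric.diam_le_of_forall_dist_le dist_nonneg
    fun x hx y hy => isMaxOn_iff.1 hmax (x, y) ⟨subset_closure hx, subset_closure hy⟩
  rcases eq_or_lt_of_le (dist_nonneg : 0 ≤ dist a b) with h0 | hpos
  · exact ⟨a, ha, b, hb, by linarith⟩
  have ht : 0 ≤ s / dist a b := div_nonneg hs hpos.le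
  refine ⟨a, ha, a + (s / dist a b) • (b - a), ?_, ?_⟩
  · refine h.convex.closure.segment_subset ha hb ?_
    rw [segment_eq_image']
    exact ⟨_, ⟨ht, (div_le_one hpos).2 (hsd.trans hle)⟩, rfl⟩
  · rw [dist_self_add_right, norm_smul, ← dist_eq_norm, dist_comm b, Real.norm_of_nonneg ht,
      div_mul_cancel₀ _ hpos.ne']

end IsConvexDomain

/-! ### Averaging over subfamilies -/

/-- Each ordered pair of distinct elements survives the removal of any of the other |S| - 2
elements. -/
lemma sum_erase_offDiag {α : Type*} [DecidableEq α] (S : Finset α) (w : α × α → ℝ) :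
    ∑ i ∈ S, ∑ p ∈ (S.erase i).offDiag, w p = (S.card - 2) * ∑ p ∈ S.offDiag, w p := by
  have h1 : ∀ i ∈ S, ∑ p ∈ (S.erase i).offDiag, w p =
      ∑ p ∈ S.offDiag, if i ≠ p.1 ∧ i ≠ p.2 then w p else 0 := by
    intro i hi
    rw [← Finset.sum_filter]
    refine Finset.sum_congr ?_ fun _ _ => rfl
    ext p
    simp only [Finset.mem_offDiag, Finset.mem_erase, Finset.mem_filter]
    tauto
  rw [Finset.sum_congr rfl h1, Finset.sum_comm, Finset.mul_sum]
  refine Finset.sum_congr rfl fun p hp => ?_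
  rw [Finset.mem_offDiag] at hp
  have hcard : (S.filter fun i => i ≠ p.1 ∧ i ≠ p.2) = (S.erase p.1).erase p.2 := by
    ext i; simp only [Finset.mem_filter, Finset.mem_erase]; tauto
  rw [← Finset.sum_filter, Finset.sum_const, hcard, nsmul_eq_mul,
    Finset.card_erase_of_mem (Finset.mem_erase.2 ⟨hp.2.2.symm, hp.2.1⟩),
    Finset.card_erase_of_mem hp.1]
  have h2 : 2 ≤ S.card := Finset.one_lt_card.2 ⟨p.1, hp.1, p.2, hp.2.1, hp.2.2⟩
  rw [show S.card - 1 - 1 = S.card - 2 by omega, Nat.cast_sub h2]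
  norm_num

/-- Some `m`-element subset carries at most the average share of the total pair weight. -/
lemma exists_subset_card_eq_sum_offDiag_le {α : Type*} [DecidableEq α] (T : Finset α)
    {w : α × α → ℝ} (hw : ∀ p, 0 ≤ w p) (d : ℕ) :
    ∀ m : ℕ, m + d = T.card → ∃ S ⊆ T, S.card = m ∧
      (T.card : ℝ) ^ 2 * ∑ p ∈ S.offDiag, w p ≤ (m : ℝ) ^ 2 * ∑ p ∈ T.offDiag, w p := by
  induction d with
  | zero => intro m hm; exact ⟨T, subset_rfl, by omega, by simp [← hm]⟩
  | succ d ih =>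
    intro m hm
    obtain ⟨S, hST, hScard, hS⟩ := ih (m + 1) (by omega)
    rcases Nat.eq_zero_or_pos m with rfl | hm0
    · exact ⟨∅, Finset.empty_subset _, rfl, by simp⟩
    set Q := ∑ p ∈ S.offDiag, w p with hQ
    set Q₀ := ∑ p ∈ T.offDiag, w p with hQ₀
    have hQ₀n : 0 ≤ Q₀ := Finset.sum_nonneg fun p _ => hw p
    have hne : S.Nonempty := Finset.card_pos.1 (by omega)
    -- Removing an average element of an (m + 1)-set scales the weight by (m - 1)/(m + 1).
    -- Multiplied by (m + 1)² this gives m² - 1 ≤ m², which closes the induction.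
    have hsum : ∑ i ∈ S, ∑ p ∈ (S.erase i).offDiag, w p ≤
        ∑ _i ∈ S, ((m : ℝ) - 1) / (m + 1) * Q := by
      rw [sum_erase_offDiag, Finset.sum_const, nsmul_eq_mul, hScard]
      apply le_of_eq
      push_cast
      field_simp
      ring
    obtain ⟨i, hi, hle⟩ := Finset.exists_le_of_sum_le hne hsum
    refine ⟨S.erase i, (Finset.erase_subset _ _).trans hST, by
      rw [Finset.card_erase_of_mem hi]; omega, ?_⟩
    have hm1 : (1 : ℝ) ≤ m := by exact_mod_cast hm0
    calc (T.card : ℝ) ^ 2 * ∑ p ∈ (S.erase i).offDiag, w p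
        ≤ (T.card : ℝ) ^ 2 * (((m : ℝ) - 1) / (m + 1) * Q) := by gcongr
      _ = ((m : ℝ) - 1) / (m + 1) * ((T.card : ℝ) ^ 2 * Q) := by ring
      _ ≤ ((m : ℝ) - 1) / (m + 1) * (((m + 1 : ℕ) : ℝ) ^ 2 * Q₀) := by
        have : 0 ≤ ((m : ℝ) - 1) / (m + 1) := div_nonneg (by linarith) (by linarith)
        gcongr
      _ = ((m : ℝ) ^ 2 - 1) * Q₀ := by
        push_cast
        field_simp
        ring
      _ ≤ (m : ℝ) ^ 2 * Q₀ := by gcongr; linarith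

/-! ### Crofton's formula for subsets of the boundary -/

/-- The lines meeting `Ω` all of whose boundary points lie in `A`. -/
def linesCaughtBy (Ω A : Set Plane) : Set (ℝ × ℝ) := linesMeeting Ω \ linesMeeting (frontier Ω \ A)

namespace IsConvexDomain

variable {Ω : Set Plane} {c : Plane}

lemma hausdorffMeasure_ne_top_of_subset (h : IsConvexDomain Ω) (hne : Ω.Nonempty) {A : Set Plane}
    (hA : A ⊆ frontier Ω) : μH[1] A ≠ ⊤ :=
  ne_top_of_le_ne_top (h.hausdorffMeasure_frontier_ne_top hne) (measure_mono hA)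

lemma nullMeasurableSet_linesMeeting_of_subset (h : IsConvexDomain Ω) (hne : Ω.Nonempty)
    {A : Set Plane} (hAm : MeasurableSet A) (hA : A ⊆ frontier Ω) :
    NullMeasurableSet (linesMeeting A) kinematicMeasure :=
  nullMeasurableSet_linesMeeting hAm.nullMeasurableSet (h.hausdorffMeasure_ne_top_of_subset hne hA)

lemma nullMeasurableSet_linesCaughtBy (h : IsConvexDomain Ω) (hne : Ω.Nonempty)
    {A : Set Plane} (hAm : MeasurableSet A) :
    NullMeasurableSet (linesCaughtBy Ω A) kinematicMeasure :=
  h.measurableSet_linesMeeting.nullMeasurableSet.diff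
    (h.nullMeasurableSet_linesMeeting_of_subset hne
      (isClosed_frontier.measurableSet.diff hAm) sdiff_subset)

/-- The two boundary points of a line give a count n of 0, 1 or 2, and n = 2 exactly for caught
lines. Thus n² - n is twice the indicator of these, and their measure is all the energy needs beyond
length. -/
lemma ae_intersectionNumber_of_subset_frontier (h : IsConvexDomain Ω) {A : Set Plane}
    (hA : A ⊆ frontier Ω) :
    ∀ᵐ q ∂kinematicMeasure,
      intersectionNumber (multiplicityOne A) q =
          (linesMeeting A).indicator 1 q + (linesCaughtBy Ω A).indicator 1 q ∧
        intersectionNumber (multiplicityOne A) q ^ 2 =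
          intersectionNumber (multiplicityOne A) q +
            (linesCaughtBy Ω A).indicator (fun _ => 2) q := by
  filter_upwards [h.ae_mem_linesMeeting, h.ae_intersectionNumber_eq_zero
    (support_multiplicityOne_subset A (hA.trans frontier_subset_closure))] with q hq hq0
  by_cases hqΩ : q ∈ linesMeeting Ω
  · obtain ⟨y, z, hyz, heq⟩ := h.exists_lineOf_inter_frontier_eq hqΩ
    have hy : y ∈ lineOf q ∩ frontier Ω := by rw [heq]; simp
    have hz : z ∈ lineOf q ∩ frontier Ω := by rw [heq]; simp
    have hmem : ∀ x, x ∈ frontier Ω → normalCoord q.1 x = q.2 → x = y ∨ x = z := by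
      intro x hx hxq
      have : x ∈ lineOf q ∩ frontier Ω := ⟨hxq, hx⟩
      rwa [heq] at this
    have hn : intersectionNumber (multiplicityOne A) q =
        multiplicityOne A y + multiplicityOne A z := by
      refine intersectionNumber_eq_pair hyz hy.1 hz.1 fun x hx hx0 => hmem x (hA ?_) hx
      by_contra h'; exact hx0 (by simp [multiplicityOne, h'])
    have hM : q ∈ linesMeeting A ↔ y ∈ A ∨ z ∈ A := by
      constructor
      · rintro ⟨x, hx, hxq⟩
        rcases hmem x (hA hx) hxq with rfl | rfl
        · exact Or.inl hx
        · exact Or.inr hx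
      · rintro (hyA | hzA)
        · exact ⟨y, hyA, hy.1⟩
        · exact ⟨z, hzA, hz.1⟩
    have hD : q ∈ linesCaughtBy Ω A ↔ y ∈ A ∧ z ∈ A := by
      constructor
      · rintro ⟨-, hq'⟩
        constructor
        · by_contra hyA; exact hq' ⟨y, ⟨hy.2, hyA⟩, hy.1⟩
        · by_contra hzA; exact hq' ⟨z, ⟨hz.2, hzA⟩, hz.1⟩
      · rintro ⟨hyA, hzA⟩
        refine ⟨hqΩ, ?_⟩
        rintro ⟨x, ⟨hxf, hxA⟩, hxq⟩
        rcases hmem x hxf hxq with rfl | rfl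
        · exact hxA hyA
        · exact hxA hzA
    rw [hn]
    by_cases hyA : y ∈ A <;> by_cases hzA : z ∈ A <;>
      simp [multiplicityOne, indicator, hM, hD, hyA, hzA]
    norm_num
  · have h1 : q ∉ linesMeeting A := fun h' =>
      hqΩ (hq (linesMeeting_mono (hA.trans frontier_subset_closure) h'))
    have h2 : q ∉ linesCaughtBy Ω A := fun h' => hqΩ h'.1
    rw [hq0 hqΩ]
    simp [h1, h2]

lemma aemeasurable_intersectionNumber (h : IsConvexDomain Ω) (hne : Ω.Nonempty) {A : Set Plane}
    (hAm : MeasurableSet A) (hA : A ⊆ frontier Ω) :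
    AEMeasurable (intersectionNumber (multiplicityOne A)) kinematicMeasure := by
  have h1 : AEMeasurable ((linesMeeting A).indicator (1 : ℝ × ℝ → ℝ≥0∞)) kinematicMeasure :=
    aemeasurable_const.indicator₀ (h.nullMeasurableSet_linesMeeting_of_subset hne hAm hA)
  have h2 : AEMeasurable ((linesCaughtBy Ω A).indicator (1 : ℝ × ℝ → ℝ≥0∞)) kinematicMeasure :=
    aemeasurable_const.indicator₀ (h.nullMeasurableSet_linesCaughtBy hne hAm)
  refine (h1.add h2).congr ?_
  filter_upwards [h.ae_intersectionNumber_of_subset_frontier hA] with q hq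
  exact hq.1.symm

/-- Crofton's formula for subsets of the boundary of a convex domain. -/
lemma lintegral_intersectionNumber_of_subset_frontier (h : IsConvexDomain Ω) (hne : Ω.Nonempty)
    {A : Set Plane} (hAm : MeasurableSet A) (hA : A ⊆ frontier Ω) :
    ∫⁻ q, intersectionNumber (multiplicityOne A) q ∂kinematicMeasure = 4 * μH[1] A := by
  have hle : ∀ {B : Set Plane}, MeasurableSet B → B ⊆ frontier Ω →
      4 * μH[1] B ≤ ∫⁻ q, intersectionNumber (multiplicityOne B) q ∂kinematicMeasure :=
    fun hBm hB => four_mul_hausdorffMeasure_le_lintegral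
      ((h.isOneRectifiable_frontier hne).mono hB hBm.nullMeasurableSet)
      (h.hausdorffMeasure_ne_top_of_subset hne hB) fun x hx => by simp [multiplicityOne, hx]
  have hAc : MeasurableSet (frontier Ω \ A) := isClosed_frontier.measurableSet.diff hAm
  have hadd : ∀ q, intersectionNumber (multiplicityOne (frontier Ω)) q =
      intersectionNumber (multiplicityOne A) q +
        intersectionNumber (multiplicityOne (frontier Ω \ A)) q := fun q => by
    simp only [intersectionNumber]
    rw [← ENNReal.tsum_add]
    refine tsum_congr fun x => ?_
    by_cases h1 : (x : Plane) ∈ A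
    · simp [multiplicityOne, h1, hA h1]
    · by_cases h2 : (x : Plane) ∈ frontier Ω <;> simp [multiplicityOne, h1, h2]
  have htot : (∫⁻ q, intersectionNumber (multiplicityOne A) q ∂kinematicMeasure) +
      ∫⁻ q, intersectionNumber (multiplicityOne (frontier Ω \ A)) q ∂kinematicMeasure =
        4 * μH[1] A + 4 * μH[1] (frontier Ω \ A) := by
    rw [← lintegral_add_left' (h.aemeasurable_intersectionNumber hne hAm hA)]
    simp_rw [← hadd]
    rw [lintegral_congr_ae h.ae_intersectionNumber_frontier,
      lintegral_indicator_const h.measurableSet_linesMeeting,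
      h.kinematicMeasure_linesMeeting_eq hne, ← mul_add, ← mul_assoc,
      measure_add_sdiff hAm.nullMeasurableSet, union_eq_self_of_subset_left hA]
    norm_num
  have hfin : 4 * μH[1] (frontier Ω \ A) ≠ ⊤ := ENNReal.mul_ne_top ENNReal.ofNat_ne_top
    (h.hausdorffMeasure_ne_top_of_subset hne sdiff_subset)
  -- The inequality half holds for `A` and for its complement in the boundary, while the sum is an
  -- equality; finiteness allows cancellation.
  refine le_antisymm ?_ (hle hAm hA)
  refine (ENNReal.add_le_add_iff_right hfin).1 ?_
  rw [← htot]
  gcongr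
  exact hle hAc sdiff_subset

lemma croftonEnergy_copiesWith_of_subset_frontier (h : IsConvexDomain Ω) (hne : Ω.Nonempty)
    (n : ℕ) {A : Set Plane} (hAm : MeasurableSet A) (hA : A ⊆ frontier Ω) {r : ℝ} (hr : 0 ≤ r)
    (hAr : μH[1] A = ENNReal.ofReal r) :
    croftonEnergy (copiesWith Ω n A) = ENNReal.ofReal (2 * n ^ 2 * boundaryLength Ω + 4 * n * r +
      (r + (kinematicMeasure (linesCaughtBy Ω A)).toReal / 2)) := by
  have hAn := h.lintegral_intersectionNumber_of_subset_frontier hne hAm hA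
  have hm := h.aemeasurable_intersectionNumber hne hAm hA
  have hfin : kinematicMeasure (linesCaughtBy Ω A) ≠ ⊤ :=
    ne_top_of_le_ne_top (h.kinematicMeasure_linesMeeting_ne_top hne) (measure_mono sdiff_subset)
  have h4 : 4 * ENNReal.ofReal r = ENNReal.ofReal (4 * r) := by
    rw [ENNReal.ofReal_mul (by norm_num), ENNReal.ofReal_ofNat]
  have hsq : ∫⁻ q, intersectionNumber (multiplicityOne A) q ^ 2 ∂kinematicMeasure =
      ENNReal.ofReal (4 * (r + (kinematicMeasure (linesCaughtBy Ω A)).toReal / 2)) := by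
    have hae : ∀ᵐ q ∂kinematicMeasure, intersectionNumber (multiplicityOne A) q ^ 2 =
        intersectionNumber (multiplicityOne A) q +
            (linesCaughtBy Ω A).indicator (fun _ => 2) q :=
      (h.ae_intersectionNumber_of_subset_frontier hA).mono fun q hq => hq.2
    rw [lintegral_congr_ae hae, lintegral_add_left' hm, hAn, hAr,
      lintegral_indicator_const₀ (h.nullMeasurableSet_linesCaughtBy hne hAm), h4,
      ← ENNReal.ofReal_toReal hfin, ← ENNReal.ofReal_ofNat 2, ← ENNReal.ofReal_mul (by norm_num),
      ← ENNReal.ofReal_add (by positivity) (by positivity), ENNReal.ofReal_toReal hfin]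
    congr 1; ring
  rw [croftonEnergy, h.lintegral_sq_copiesWith hne n (hA.trans frontier_subset_closure) hm, hAn,
    hAr, hsq, h4]
  exact h.energy_eq_ofReal hne n hr (by positivity)

end IsConvexDomain

/-! ### Equal arcs and the choice of a well-spread subset -/

/-- An arc-length parametrization of the boundary of `Ω`. -/
structure IsArclengthParam (Ω : Set Plane) (σ : ℝ → Plane) : Prop where
  bijOn : BijOn σ (Ico 0 (boundaryLength Ω)) (frontier Ω)
  measurableSet : ∀ a b, 0 ≤ a → a ≤ b → b ≤ boundaryLength Ω → MeasurableSet (σ '' Ico a b)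
  length : ∀ a b, 0 ≤ a → a ≤ b → b ≤ boundaryLength Ω →
    μH[1] (σ '' Ico a b) = ENNReal.ofReal (b - a)

/-- The `i`-th of `N` boundary arcs of equal length. -/
def boundaryArc (Ω : Set Plane) (σ : ℝ → Plane) (N i : ℕ) : Set Plane :=
  σ '' Ico (boundaryLength Ω * i / N) (boundaryLength Ω * (i + 1) / N)

namespace IsArclengthParam

variable {Ω : Set Plane} {σ : ℝ → Plane} {N i j : ℕ}

lemma endpoints (hP : 0 < boundaryLength Ω) (hi : i < N) :
    0 ≤ boundaryLength Ω * i / N ∧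
      boundaryLength Ω * (i + 1) / N = boundaryLength Ω * i / N + boundaryLength Ω / N ∧
      0 < boundaryLength Ω / N ∧ boundaryLength Ω * (i + 1) / N ≤ boundaryLength Ω := by
  have hN : (0 : ℝ) < N := Nat.cast_pos.2 (by omega)
  have hiN : (i : ℝ) + 1 ≤ N := by exact_mod_cast hi
  refine ⟨by positivity, by ring, by positivity, ?_⟩
  rw [div_le_iff₀ hN]
  gcongr

lemma boundaryArc_subset (hσ : IsArclengthParam Ω σ) (hP : 0 < boundaryLength Ω) (hi : i < N) :
    boundaryArc Ω σ N i ⊆ frontier Ω := by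
  obtain ⟨h1, -, -, h4⟩ := endpoints hP hi
  rw [← hσ.bijOn.image_eq]
  exact image_mono (Ico_subset_Ico h1 h4)

lemma measurableSet_boundaryArc (hσ : IsArclengthParam Ω σ) (hP : 0 < boundaryLength Ω)
    (hi : i < N) : MeasurableSet (boundaryArc Ω σ N i) := by
  obtain ⟨h1, h2, h3, h4⟩ := endpoints hP hi
  exact hσ.measurableSet _ _ h1 (by linarith) h4

lemma length_boundaryArc (hσ : IsArclengthParam Ω σ) (hP : 0 < boundaryLength Ω)
    (hi : i < N) : μH[1] (boundaryArc Ω σ N i) = ENNReal.ofReal (boundaryLength Ω / N) := by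
  obtain ⟨h1, h2, h3, h4⟩ := endpoints hP hi
  rw [boundaryArc, hσ.length _ _ h1 (by linarith) h4, h2, add_sub_cancel_left]

lemma disjoint_boundaryArc (hσ : IsArclengthParam Ω σ) (hP : 0 < boundaryLength Ω)
    (hi : i < N) (hj : j < N) (hij : i ≠ j) :
    Disjoint (boundaryArc Ω σ N i) (boundaryArc Ω σ N j) := by
  wlog hlt : i < j generalizing i j with H
  · exact (H hj hi hij.symm (by omega)).symm
  obtain ⟨h1, h2, h3, h4⟩ := endpoints hP hi
  obtain ⟨k1, k2, k3, k4⟩ := endpoints hP hj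
  refine Disjoint.image ?_ hσ.bijOn.injOn (Ico_subset_Ico h1 h4) (Ico_subset_Ico k1 k4)
  rw [Ico_disjoint_Ico]
  refine (min_le_left _ _).trans (le_trans ?_ (le_max_right _ _))
  have : (i : ℝ) + 1 ≤ j := by exact_mod_cast hlt
  gcongr

/-- Few lines meet the boundary twice within one of `N` arcs, if `N` is large. -/
lemma tendsto_kinematicMeasure_caught (hΩ : IsConvexDomain Ω) (hne : Ω.Nonempty)
    (hσ : IsArclengthParam Ω σ) :
    Tendsto (fun N => kinematicMeasure
      (⋃ i ∈ Finset.range N, linesCaughtBy Ω (boundaryArc Ω σ N i))) atTop (𝓝 0) := by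
  have hP := hΩ.boundaryLength_pos hne
  let E : ℕ → Set (ℝ × ℝ) := fun N => ⋃ i ∈ Finset.range N, linesCaughtBy Ω (boundaryArc Ω σ N i)
  have hEm : ∀ N, NullMeasurableSet (E N) kinematicMeasure := fun N =>
    NullMeasurableSet.biUnion (Finset.range N).countable_toSet fun i hi =>
      hΩ.nullMeasurableSet_linesCaughtBy hne
        (hσ.measurableSet_boundaryArc hP (Finset.mem_range.1 (by simpa using hi)))
  have hEsub : ∀ N, E N ⊆ linesMeeting Ω := fun N => iUnion₂_subset fun i _ => sdiff_subset
  have key : Tendsto (fun N => ∫⁻ q, (E N).indicator 1 q ∂kinematicMeasure) atTop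
      (𝓝 (∫⁻ _, 0 ∂kinematicMeasure)) := by
    refine tendsto_lintegral_of_dominated_convergence' ((linesMeeting Ω).indicator 1)
      (fun N => aemeasurable_const.indicator₀ (hEm N)) (fun N => ae_of_all _ fun q =>
        indicator_le_indicator_of_subset (hEsub N) (fun _ => zero_le) q) ?_
      (ae_of_all _ fun q => ?_)
    · rw [lintegral_indicator_one hΩ.measurableSet_linesMeeting]
      exact hΩ.kinematicMeasure_linesMeeting_ne_top hne
    · by_cases hq : q ∈ linesMeeting Ω
      · obtain ⟨y, z, hyz, heq⟩ := hΩ.exists_lineOf_inter_frontier_eq hq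
        have hy : y ∈ lineOf q ∩ frontier Ω := by rw [heq]; simp
        have hz : z ∈ lineOf q ∩ frontier Ω := by rw [heq]; simp
        obtain ⟨a, ha, rfl⟩ := hσ.bijOn.surjOn hy.2
        obtain ⟨b, hb, rfl⟩ := hσ.bijOn.surjOn hz.2
        -- Dominated convergence reduces the claim to a single line. Once the arcs are shorter than
        -- the parameter distance of its two boundary points, no single arc contains both.
        have hab : 0 < |a - b| := abs_pos.2 (sub_ne_zero.2 fun h' => hyz (by rw [h']))
        obtain ⟨N₀, hN₀⟩ := exists_nat_gt (boundaryLength Ω / |a - b|)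
        refine tendsto_const_nhds.congr' ?_
        filter_upwards [eventually_ge_atTop N₀] with N hN
        rw [indicator_of_notMem]
        intro hqE
        obtain ⟨i, hi, hqi⟩ := mem_iUnion₂.1 hqE
        have hi' := Finset.mem_range.1 hi
        obtain ⟨h1, h2, h3, h4⟩ := endpoints hP hi'
        have hmem : ∀ u ∈ Ico 0 (boundaryLength Ω), σ u ∈ lineOf q →
            u ∈ Ico (boundaryLength Ω * i / N) (boundaryLength Ω * (i + 1) / N) := by
          intro u hu huq
          by_contra hcon
          refine hqi.2 ⟨σ u, ⟨hσ.bijOn.mapsTo hu, ?_⟩, huq⟩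
          rintro ⟨u', hu', hσu⟩
          have := hσ.bijOn.injOn (Ico_subset_Ico h1 h4 hu') hu hσu
          exact hcon (this ▸ hu')
        have haI := hmem a ha hy.1
        have hbI := hmem b hb hz.1
        have hlt : |a - b| < boundaryLength Ω / N := by
          rw [abs_lt]; constructor <;> linarith [haI.1, haI.2, hbI.1, hbI.2]
        have hN0 : (0 : ℝ) < N := Nat.cast_pos.2 (by omega)
        have hNr : (N₀ : ℝ) ≤ N := Nat.cast_le.2 hN
        rw [div_lt_iff₀ hab] at hN₀
        rw [lt_div_iff₀ hN0] at hlt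
        nlinarith
      · refine tendsto_const_nhds.congr fun N => ?_
        rw [indicator_of_notMem fun h' => hq (hEsub N h')]
  simp only [lintegral_zero] at key
  refine key.congr fun N => ?_
  rw [lintegral_indicator_one₀ (hEm N)]

/-- A choice of arcs that captures few lines twice. -/
lemma exists_subset_caught_le (hΩ : IsConvexDomain Ω) (hne : Ω.Nonempty)
    (hσ : IsArclengthParam Ω σ) {r : ℝ} (hr : 0 ≤ r) (hrP : r < boundaryLength Ω) (hN : 0 < N) :
    ∃ A ⊆ frontier Ω, MeasurableSet A ∧ μH[1] A = ENNReal.ofReal r ∧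
      kinematicMeasure (linesCaughtBy Ω A) ≤
        kinematicMeasure (⋃ i ∈ Finset.range N, linesCaughtBy Ω (boundaryArc Ω σ N i)) +
          ENNReal.ofReal (4 * boundaryLength Ω / N) +
          ENNReal.ofReal (2 * r ^ 2 / boundaryLength Ω) := by
  classical
  have hP := hΩ.boundaryLength_pos hne
  set P := boundaryLength Ω with hPdef
  have hN' : (0 : ℝ) < N := Nat.cast_pos.2 hN
  -- Lines joining two different arcs. Only increasing index pairs carry weight, so each such line
  -- is counted once and not once per order.
  set W : ℕ × ℕ → Set (ℝ × ℝ) := fun p => if p.1 < p.2 then linesMeeting Ω ∩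
    (linesMeeting (boundaryArc Ω σ N p.1) ∩ linesMeeting (boundaryArc Ω σ N p.2)) else ∅ with hW
  have hWsub : ∀ p, W p ⊆ linesMeeting Ω := fun p => by
    simp only [hW]; split_ifs
    · exact inter_subset_left
    · exact empty_subset _
  have hHfin := hΩ.kinematicMeasure_linesMeeting_ne_top hne
  have hWfin : ∀ p, kinematicMeasure (W p) ≠ ⊤ := fun p =>
    ne_top_of_le_ne_top hHfin (measure_mono (hWsub p))
  have hWm : ∀ p ∈ (Finset.range N).offDiag, NullMeasurableSet (W p) kinematicMeasure := by
    intro p hp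
    rw [Finset.mem_offDiag, Finset.mem_range, Finset.mem_range] at hp
    simp only [hW]; split_ifs
    · have hm : ∀ i < N, NullMeasurableSet (linesMeeting (boundaryArc Ω σ N i)) kinematicMeasure :=
        fun i hi => hΩ.nullMeasurableSet_linesMeeting_of_subset hne
          (hσ.measurableSet_boundaryArc hP hi) (hσ.boundaryArc_subset hP hi)
      exact hΩ.measurableSet_linesMeeting.nullMeasurableSet.inter
        ((hm _ hp.1).inter (hm _ hp.2.1))
    · exact MeasurableSet.empty.nullMeasurableSet
  -- The arcs are disjoint and a line has only two boundary points, so it determines the pair of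
  -- arcs. The weights therefore sum to at most 2P.
  have hWdisj : ∀ p ∈ (Finset.range N).offDiag, ∀ p' ∈ (Finset.range N).offDiag, p ≠ p' →
      Disjoint (W p) (W p') := by
    intro p hp p' hp' hpp
    rw [Finset.mem_offDiag, Finset.mem_range, Finset.mem_range] at hp hp'
    rw [disjoint_left]
    intro q hq hq'
    simp only [hW] at hq hq'
    split_ifs at hq hq' with hlt hlt'
    · obtain ⟨y, z, hyz, heq⟩ := hΩ.exists_lineOf_inter_frontier_eq hq.1
      have huniq : ∀ {i j : ℕ}, i < N → j < N → ∀ x, x ∈ boundaryArc Ω σ N i →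
          x ∈ boundaryArc Ω σ N j → i = j := fun hi hj x hx hx' => by
        by_contra hne'
        exact disjoint_left.1 (hσ.disjoint_boundaryArc hP hi hj hne') hx hx'
      have hpt : ∀ i < N, q ∈ linesMeeting (boundaryArc Ω σ N i) →
          y ∈ boundaryArc Ω σ N i ∨ z ∈ boundaryArc Ω σ N i := by
        rintro i hi ⟨x, hx, hxq⟩
        have : x ∈ lineOf q ∩ frontier Ω := ⟨hxq, hσ.boundaryArc_subset hP hi hx⟩
        rw [heq] at this
        rcases this with rfl | rfl
        · exact Or.inl hx
        · exact Or.inr hx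
      have e1 := hpt _ hp.1 hq.2.1
      have e2 := hpt _ hp.2.1 hq.2.2
      have e3 := hpt _ hp'.1 hq'.2.1
      have e4 := hpt _ hp'.2.1 hq'.2.2
      apply hpp
      have hd := hp.2.2
      have hd' := hp'.2.2
      have u12 := fun x => huniq hp.1 hp.2.1 x
      have u34 := fun x => huniq hp'.1 hp'.2.1 x
      have u13 := fun x => huniq hp.1 hp'.1 x
      have u14 := fun x => huniq hp.1 hp'.2.1 x
      have u23 := fun x => huniq hp.2.1 hp'.1 x
      have u24 := fun x => huniq hp.2.1 hp'.2.1 x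
      ext
      · grind
      · grind
    all_goals simp_all
  set w : ℕ × ℕ → ℝ := fun p => (kinematicMeasure (W p)).toReal with hw
  have hwtot : ∑ p ∈ (Finset.range N).offDiag, w p ≤ 2 * P := by
    have h1 : ∑ p ∈ (Finset.range N).offDiag, kinematicMeasure (W p) ≤
        kinematicMeasure (linesMeeting Ω) := by
      rw [← measure_biUnion_finset₀ (fun p hp p' hp' hne' =>
        (hWdisj p hp p' hp' hne').aedisjoint) hWm]
      exact measure_mono (iUnion₂_subset fun p _ => hWsub p)
    have h2 := ENNReal.toReal_mono hHfin h1
    rw [ENNReal.toReal_sum fun p _ => hWfin p, hΩ.kinematicMeasure_linesMeeting_eq hne,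
      ENNReal.toReal_mul, ENNReal.toReal_ofNat] at h2
    exact h2
  -- The number of whole arcs fitting into length r. It is less than N, which leaves a spare arc `k`
  -- to hold the remaining length ρ < P/N.
  set m := ⌊r * N / P⌋₊ with hm
  have hmle : (m : ℝ) ≤ r * N / P := Nat.floor_le (by positivity)
  have hmlt : r * N / P < m + 1 := Nat.lt_floor_add_one _
  have hmN : m < N := by
    have : (m : ℝ) < N := hmle.trans_lt (by rw [div_lt_iff₀ hP]; nlinarith)
    exact_mod_cast this
  rw [le_div_iff₀ hP] at hmle
  rw [div_lt_iff₀ hP] at hmlt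
  obtain ⟨S, hS, hScard, hSw⟩ := exists_subset_card_eq_sum_offDiag_le (Finset.range N)
    (w := w) (fun p => ENNReal.toReal_nonneg) (N - m) m (by rw [Finset.card_range]; omega)
  rw [Finset.card_range] at hSw
  have hSN : ∀ i ∈ S, i < N := fun i hi => Finset.mem_range.1 (hS hi)
  obtain ⟨k, hkN, hkS⟩ : ∃ k < N, k ∉ S := by
    by_contra! hcon
    have : (Finset.range N).card ≤ S.card :=
      Finset.card_le_card fun i hi => hcon i (Finset.mem_range.1 hi)
    rw [Finset.card_range] at this
    omega
  set ρ := r - m * P / N with hρ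
  have hρ0 : 0 ≤ ρ := by
    rw [hρ, sub_nonneg, div_le_iff₀ hN']; linarith
  have hρN : ρ < P / N := by
    rw [hρ, sub_lt_iff_lt_add, ← add_div, lt_div_iff₀ hN']; linarith
  obtain ⟨e1, e2, e3, e4⟩ := endpoints hP hkN
  set R := σ '' Ico (P * k / N) (P * k / N + ρ) with hR
  have hRk : R ⊆ boundaryArc Ω σ N k := image_mono (Ico_subset_Ico le_rfl (by rw [e2]; linarith))
  have hRf : R ⊆ frontier Ω := hRk.trans (hσ.boundaryArc_subset hP hkN)
  have hRm : MeasurableSet R := hσ.measurableSet _ _ e1 (by linarith) (by linarith)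
  have hRl : μH[1] R = ENNReal.ofReal ρ := by
    rw [hR, hσ.length _ _ e1 (by linarith) (by linarith), add_sub_cancel_left]
  set A₀ := ⋃ i ∈ S, boundaryArc Ω σ N i with hA₀
  have hA₀m : MeasurableSet A₀ := Finset.measurableSet_biUnion S fun i hi =>
    hσ.measurableSet_boundaryArc hP (hSN i hi)
  have hA₀f : A₀ ⊆ frontier Ω := iUnion₂_subset fun i hi => hσ.boundaryArc_subset hP (hSN i hi)
  have hA₀l : μH[1] A₀ = ENNReal.ofReal (m * P / N) := by
    rw [hA₀, measure_biUnion_finset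
      (fun i hi j hj hij => hσ.disjoint_boundaryArc hP (hSN i hi) (hSN j hj) hij)
      fun i hi => hσ.measurableSet_boundaryArc hP (hSN i hi),
      Finset.sum_congr rfl fun i hi => hσ.length_boundaryArc hP (hSN i hi), Finset.sum_const,
      hScard, nsmul_eq_mul, ← ENNReal.ofReal_natCast, ← ENNReal.ofReal_mul (by positivity),
      mul_div_assoc]
  refine ⟨A₀ ∪ R, union_subset hA₀f hRf, hA₀m.union hRm, ?_, ?_⟩
  · rw [measure_union _ hRm, hA₀l, hRl, ← ENNReal.ofReal_add (by positivity) hρ0, hρ]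
    · congr 1; ring
    · rw [hA₀, disjoint_iUnion₂_left]
      intro i hi
      exact (hσ.disjoint_boundaryArc hP (hSN i hi) hkN (fun h' => hkS (h' ▸ hi))).mono_right hRk
  -- A caught line meets the remainder, or has both points in one chosen arc, or joins two chosen
  -- arcs. These cases give the three terms of the bound.
  have hcover : linesCaughtBy Ω (A₀ ∪ R) ⊆
      ((⋃ i ∈ Finset.range N, linesCaughtBy Ω (boundaryArc Ω σ N i)) ∪ linesMeeting R) ∪
        ⋃ p ∈ S.offDiag, W p := by
    intro q hq
    by_cases hqR : q ∈ linesMeeting R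
    · exact Or.inl (Or.inr hqR)
    obtain ⟨y, z, hyz, heq⟩ := hΩ.exists_lineOf_inter_frontier_eq hq.1
    have hmem : ∀ x ∈ lineOf q ∩ frontier Ω, ∃ i ∈ S, x ∈ boundaryArc Ω σ N i := by
      intro x hx
      have hxA : x ∈ A₀ ∪ R := by
        by_contra hcon; exact hq.2 ⟨x, ⟨hx.2, hcon⟩, hx.1⟩
      rcases hxA with hxA | hxR
      · simpa [hA₀] using hxA
      · exact absurd ⟨x, hxR, hx.1⟩ hqR
    have hy : y ∈ lineOf q ∩ frontier Ω := by rw [heq]; simp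
    have hz : z ∈ lineOf q ∩ frontier Ω := by rw [heq]; simp
    obtain ⟨i, hi, hyi⟩ := hmem y hy
    obtain ⟨j, hj, hzj⟩ := hmem z hz
    have hyq : q ∈ linesMeeting (boundaryArc Ω σ N i) := ⟨y, hyi, hy.1⟩
    have hzq : q ∈ linesMeeting (boundaryArc Ω σ N j) := ⟨z, hzj, hz.1⟩
    rcases lt_trichotomy i j with hij | rfl | hij
    · refine Or.inr (mem_iUnion₂.2 ⟨(i, j), Finset.mem_offDiag.2 ⟨hi, hj, hij.ne⟩, ?_⟩)
      simp only [hW, if_pos hij]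
      exact ⟨hq.1, hyq, hzq⟩
    · refine Or.inl (Or.inl (mem_iUnion₂.2 ⟨i, hS hi, hq.1, ?_⟩))
      rintro ⟨x, ⟨hxf, hxi⟩, hxq⟩
      have hx : x ∈ lineOf q ∩ frontier Ω := ⟨hxq, hxf⟩
      rw [heq] at hx
      rcases hx with rfl | rfl
      · exact hxi hyi
      · exact hxi hzj
    · refine Or.inr (mem_iUnion₂.2 ⟨(j, i), Finset.mem_offDiag.2 ⟨hj, hi, hij.ne⟩, ?_⟩)
      simp only [hW, if_pos hij]
      exact ⟨hq.1, hzq, hyq⟩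
  have hRle : kinematicMeasure (linesMeeting R) ≤ ENNReal.ofReal (4 * P / N) := by
    have h1 : kinematicMeasure (linesMeeting R) ≤
        ∫⁻ q, intersectionNumber (multiplicityOne R) q ∂kinematicMeasure := by
      rw [← lintegral_indicator_one₀ (hΩ.nullMeasurableSet_linesMeeting_of_subset hne hRm hRf)]
      refine lintegral_mono_ae ?_
      filter_upwards [hΩ.ae_intersectionNumber_of_subset_frontier hRf] with q hq
      rw [hq.1]
      exact le_self_add
    refine h1.trans ?_
    rw [hΩ.lintegral_intersectionNumber_of_subset_frontier hne hRm hRf, hRl, mul_div_assoc,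
      ENNReal.ofReal_mul (by norm_num), ENNReal.ofReal_ofNat]
    gcongr
  have hWle : kinematicMeasure (⋃ p ∈ S.offDiag, W p) ≤ ENNReal.ofReal (2 * r ^ 2 / P) := by
    refine (measure_biUnion_finset_le _ _).trans ?_
    rw [← Finset.sum_congr rfl fun p _ => ENNReal.ofReal_toReal (hWfin p),
      ← ENNReal.ofReal_sum_of_nonneg fun p _ => ENNReal.toReal_nonneg]
    apply ENNReal.ofReal_le_ofReal
    rw [le_div_iff₀ hP]
    have hw0 : 0 ≤ ∑ p ∈ (Finset.range N).offDiag, w p :=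
      Finset.sum_nonneg fun p _ => ENNReal.toReal_nonneg
    have h1 : (N : ℝ) ^ 2 * ∑ p ∈ S.offDiag, w p ≤ (m : ℝ) ^ 2 * (2 * P) :=
      hSw.trans (by gcongr)
    -- The averaged weight is at most (m/N)²·2P, and m/N ≤ r/P.
    have h2 : ((m : ℝ) * P) ^ 2 ≤ (r * N) ^ 2 := by gcongr
    have h3 : (N : ℝ) ^ 2 * ((∑ p ∈ S.offDiag, w p) * P) ≤ (N : ℝ) ^ 2 * (2 * r ^ 2) := by
      nlinarith
    exact le_of_mul_le_mul_left h3 (by positivity)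
  calc kinematicMeasure (linesCaughtBy Ω (A₀ ∪ R)) ≤ _ := measure_mono hcover
    _ ≤ _ := (measure_union_le _ _).trans
      (add_le_add ((measure_union_le _ _).trans (add_le_add le_rfl hRle)) hWle)

end IsArclengthParam

/-! ### The two bounds and the equality case -/

/-- The correction vanishes at L = kP/2 and L = (k + 1)P/2, so the right side is the chord of the
parabola 2L²/P between these values. With k the floor of 2L/P this identifies the lower bound. -/
lemma quadratic_add_linear_identity (P L : ℝ) (hP : 0 < P) (k : ℝ) :
    2 * L ^ 2 / P + P / 2 * (2 * L / P - k) * (1 - (2 * L / P - k)) =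
      (2 * k + 1) * L - k * (k + 1) * P / 2 := by
  field_simp
  ring

namespace IsConvexDomain

variable {Ω : Set Plane}

/-- The lower bound for the minimal energy. -/
lemma ofReal_le_minEnergy (h : IsConvexDomain Ω) (hne : Ω.Nonempty) {L : ℝ} (hL : 0 ≤ L) :
    ENNReal.ofReal (2 * L ^ 2 / boundaryLength Ω +
      boundaryLength Ω / 2 * Int.fract (2 * L / boundaryLength Ω) *
        (1 - Int.fract (2 * L / boundaryLength Ω))) ≤ minEnergy Ω L := by
  have hP := h.boundaryLength_pos hne
  refine le_iInf₂ fun θ hθ => ?_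
  have h0 : 0 ≤ 2 * L / boundaryLength Ω := by positivity
  have hfl : ((⌊2 * L / boundaryLength Ω⌋₊ : ℕ) : ℝ) = (⌊2 * L / boundaryLength Ω⌋ : ℝ) :=
    natCast_floor_eq_intCast_floor h0
  rw [Int.fract, ← hfl, quadratic_add_linear_identity _ _ hP]
  exact h.ofReal_le_croftonEnergy hne hθ _

/-- The upper bound for the minimal energy. -/
lemma minEnergy_le (h : IsConvexDomain Ω) (hne : Ω.Nonempty) {L : ℝ} (hL : 0 ≤ L) :
    minEnergy Ω L ≤ ENNReal.ofReal (2 * L ^ 2 / boundaryLength Ω + boundaryLength Ω / 4) := by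
  have hP := h.boundaryLength_pos hne
  obtain ⟨σ, hbij, hσ'⟩ := h.exists_arclength_param hne
  have hσ : IsArclengthParam Ω σ := ⟨hbij, fun a b ha hab hb => (hσ' a b ha hab hb).1,
    fun a b ha hab hb => (hσ' a b ha hab hb).2⟩
  set P := boundaryLength Ω with hPdef
  set n := ⌊L / P⌋₊ with hn
  set r := L - n * P with hr
  have hr0 : 0 ≤ r := by
    have := Nat.floor_le (by positivity : 0 ≤ L / P)
    rw [le_div_iff₀ hP] at this
    linarith
  have hrP : r < P := by
    have := Nat.lt_floor_add_one (L / P)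
    rw [div_lt_iff₀ hP] at this
    linarith
  refine ENNReal.le_of_forall_pos_le_add fun δ hδ _ => ?_
  have hδ' : (0 : ℝ) < δ := hδ
  have hlim : Tendsto (fun N : ℕ => kinematicMeasure (⋃ i ∈ Finset.range N,
      linesCaughtBy Ω (boundaryArc Ω σ N i)) + ENNReal.ofReal (4 * P / N)) atTop (𝓝 (0 + 0)) := by
    refine (hσ.tendsto_kinematicMeasure_caught h hne).add ?_
    have := ENNReal.tendsto_ofReal (tendsto_const_div_atTop_nhds_zero_nat (4 * P))
    rwa [ENNReal.ofReal_zero] at this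
  rw [add_zero] at hlim
  have hev := hlim.eventually (gt_mem_nhds (show (0 : ℝ≥0∞) < δ by exact_mod_cast hδ))
  obtain ⟨N, hNδ, hN⟩ := (hev.and (eventually_gt_atTop 0)).exists
  obtain ⟨A, hAf, hAm, hAr, hAD⟩ := hσ.exists_subset_caught_le h hne hr0 hrP hN
  have hDle : (kinematicMeasure (linesCaughtBy Ω A)).toReal ≤ δ + 2 * r ^ 2 / P := by
    have h1 : kinematicMeasure (linesCaughtBy Ω A) ≤ ENNReal.ofReal (δ + 2 * r ^ 2 / P) := by
      rw [ENNReal.ofReal_add hδ'.le (by positivity), ENNReal.ofReal_coe_nnreal]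
      exact hAD.trans (by gcongr)
    exact ENNReal.toReal_le_of_le_ofReal (by positivity) h1
  have hcomp : IsCompetitor Ω L (copiesWith Ω n A) :=
    h.isCompetitor_copiesWith hne hAm (hAf.trans frontier_subset_closure)
      ((h.isOneRectifiable_frontier hne).mono hAf hAm.nullMeasurableSet) hr0 hAr (by rw [hr]; ring)
  refine (iInf₂_le _ hcomp).trans ?_
  rw [h.croftonEnergy_copiesWith_of_subset_frontier hne n hAm hAf hr0 hAr,
    ← ENNReal.ofReal_coe_nnreal, ← ENNReal.ofReal_add (by positivity) hδ'.le]
  apply ENNReal.ofReal_le_ofReal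
  have hLr : L = n * P + r := by rw [hr]; ring
  -- The slack in r - r²/P ≤ P/4 is (r - P/2)²/P.
  have hid : 2 * L ^ 2 / P + P / 4 - (2 * n ^ 2 * P + 4 * n * r + (r + r ^ 2 / P)) =
      (r - P / 2) ^ 2 / P := by
    rw [hLr]; field_simp; ring
  have hpos : 0 ≤ (r - P / 2) ^ 2 / P := by positivity
  have : 2 * r ^ 2 / P = 2 * (r ^ 2 / P) := by ring
  rw [← hPdef]
  linarith

/-- The energy of `n` copies of the boundary with a segment equals the lower bound. -/
lemma energy_identity {P L s : ℝ} (hP : 0 < P) {n : ℕ} (hL : L = n * P + s) (hs : 0 ≤ s)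
    (hsP : 2 * s ≤ P) :
    2 * n ^ 2 * P + 4 * n * s + s =
      2 * L ^ 2 / P + P / 2 * Int.fract (2 * L / P) * (1 - Int.fract (2 * L / P)) := by
  have hx : 2 * L / P = ((2 * n : ℕ) : ℝ) + 2 * s / P := by
    rw [hL]; push_cast; field_simp
  rcases hsP.lt_or_eq with hlt | heq
  · have hf : Int.fract (2 * L / P) = 2 * L / P - (2 * n : ℕ) := by
      rw [hx, Int.fract_natCast_add, Int.fract_eq_self.2 ⟨by positivity, (div_lt_one hP).2 hlt⟩]
      ring
    rw [hf, quadratic_add_linear_identity _ _ hP, hL]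
    push_cast
    ring
  -- At 2s = P the fractional part wraps to 0, but both sides of the identity are continuous there
  -- and still agree.
  · have hf : Int.fract (2 * L / P) = 0 := by
      rw [hx, heq, div_self hP.ne', Int.fract_natCast_add, Int.fract_one]
    rw [hf, hL, ← heq]
    have hs0 : s ≠ 0 := fun h0 => by rw [h0] at heq; linarith
    field_simp
    ring

end IsConvexDomain

theorem theorem3 (Ω : Set Plane) (hne : Ω.Nonempty) (hopen : IsOpen Ω)
    (hbdd : Bornology.IsBounded Ω) (hconv : Convex ℝ Ω) (hC1 : HasC1Boundary Ω)
    (L : ℝ) (hL : 0 ≤ L) :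
    minEnergy Ω L ≠ ⊤ ∧
    boundaryLength Ω / 2 * Int.fract (2 * L / boundaryLength Ω) *
        (1 - Int.fract (2 * L / boundaryLength Ω))
      ≤ (minEnergy Ω L).toReal - 2 * L ^ 2 / boundaryLength Ω ∧
    (minEnergy Ω L).toReal - 2 * L ^ 2 / boundaryLength Ω ≤ boundaryLength Ω / 4 ∧
    ∀ n : ℕ, n * boundaryLength Ω ≤ L → L ≤ n * boundaryLength Ω + Metric.diam Ω →
      (minEnergy Ω L).toReal - 2 * L ^ 2 / boundaryLength Ω
        = boundaryLength Ω / 2 * Int.fract (2 * L / boundaryLength Ω) *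
            (1 - Int.fract (2 * L / boundaryLength Ω)) ∧
      (∃ a ∈ closure Ω, ∃ b ∈ closure Ω, dist a b = L - n * boundaryLength Ω) ∧
      ∀ a ∈ closure Ω, ∀ b ∈ closure Ω, dist a b = L - n * boundaryLength Ω →
        IsCompetitor Ω L (copiesWithSegment Ω n a b) ∧
        croftonEnergy (copiesWithSegment Ω n a b) = minEnergy Ω L := by
  have h : IsConvexDomain Ω := ⟨hopen, hbdd, hconv⟩
  have hP := h.boundaryLength_pos hne
  have hlow := h.ofReal_le_minEnergy hne hL
  have hup := h.minEnergy_le hne hL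
  have hfin : minEnergy Ω L ≠ ⊤ := ne_top_of_le_ne_top ENNReal.ofReal_ne_top hup
  have hlow' := (ENNReal.ofReal_le_iff_le_toReal hfin).1 hlow
  have hup' := ENNReal.toReal_le_of_le_ofReal (by positivity) hup
  have hseg : ∀ n : ℕ, ∀ a ∈ closure Ω, ∀ b ∈ closure Ω, dist a b = L - n * boundaryLength Ω →
      IsCompetitor Ω L (copiesWithSegment Ω n a b) ∧
        croftonEnergy (copiesWithSegment Ω n a b) = minEnergy Ω L := by
    intro n a ha b hb hab
    have hcomp : IsCompetitor Ω L (copiesWithSegment Ω n a b) := by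
      rw [copiesWithSegment_eq]
      refine h.isCompetitor_copiesWith hne (isCompact_segment a b).measurableSet
        (h.convex.closure.segment_subset ha hb) (isOneRectifiable_segment a b) dist_nonneg
        (r := dist a b) ?_ (by rw [hab]; ring)
      rw [hausdorffMeasure_segment, edist_dist]
    -- The energy of this competitor equals the universal lower bound, so it is minimal.
    refine ⟨hcomp, le_antisymm ?_ (iInf₂_le _ hcomp)⟩
    rw [copiesWithSegment_eq, h.croftonEnergy_copiesWith_segment hne n ha hb,
      IsConvexDomain.energy_identity (L := L) hP (by rw [hab]; ring) dist_nonneg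
        (h.two_mul_dist_le_boundaryLength hne ha hb)]
    exact hlow
  refine ⟨hfin, by linarith, by linarith, fun n hn1 hn2 => ?_⟩
  have hex := h.exists_dist_eq hne (sub_nonneg.2 hn1) (by linarith)
  refine ⟨?_, hex, hseg n⟩
  obtain ⟨a, ha, b, hb, hab⟩ := hex
  obtain ⟨-, heq⟩ := hseg n a ha b hb hab
  rw [copiesWithSegment_eq, h.croftonEnergy_copiesWith_segment hne n ha hb,
    IsConvexDomain.energy_identity (L := L) hP (by rw [hab]; ring) dist_nonneg
      (h.two_mul_dist_le_boundaryLength hne ha hb)] at heq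
  have hf0 := Int.fract_nonneg (2 * L / boundaryLength Ω)
  have hf1 := (Int.fract_lt_one (2 * L / boundaryLength Ω)).le
  rw [← heq, ENNReal.toReal_ofReal]
  · ring
  · have := mul_nonneg (mul_nonneg (by positivity : 0 ≤ boundaryLength Ω / 2) hf0)
      (sub_nonneg.2 hf1)
    positivity

end
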